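/- Let $n\ge 2$, $1\le k<n$ and $\sigma\in\mathfrak S_n$, written $\sigma=\sigma_1\cdots\sigma_n$, with $\sigma\mu=\sigma\circ\mu$, so that $\sigma\,(a,b)$ exchanges the entries of $\sigma$ in positions $a$ and $b$. Let $s_i=(i,i+1)$, let $\ell$ be the length (the minimal number of factors in a decomposition into $s_i$'s), let $\omega=n\,(n-1)\cdots 1$, and let $\le$ be the Bruhat order, i.e. the reflexive transitive closure of the relations $\sigma<\sigma\tau$ with $\tau$ a transposition and $\ell(\sigma\tau)=\ell(\sigma)+1$. On $L=\mathbb Z[x_1^{\pm1},\dots,x_n^{\pm1},y_1^{\pm1},\dots,y_n^{\pm1}]$ consider, for $1\le i<n$, the operators (acting on the right) $$f\pi_i=\frac{x_if-x_{i+1}\,(f s_i)}{x_i-x_{i+1}},\qquad f\hat\pi_i=\frac{x_{i+1}(f-f s_i)}{x_i-x_{i+1}},$$ where $f s_i$ is $f$ with $x_i$ and $x_{i+1}$ exchanged; for a reduced decomposition $\mu=s_{i_1}\cdots s_{i_m}$ put $\pi_\mu=\pi_{i_1}\cdots\pi_{i_m}$ and $\hat\pi_\mu=\hat\pi_{i_1}\cdots\hat\pi_{i_m}$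 (these do not depend on the decomposition). The double Grothendieck polynomials are $$G_\omega=\prod_{\substack{i,j\ge1\\ i+j\le n}}\Bigl(1-\frac{y_j}{x_i}\Bigr),\qquad G_\mu=G_\omega\,\pi_{\omega\mu}\quad(\mu\in\mathfrak S_n).$$ Let $I\subset L$ be the ideal generated by all $f(x_1,\dots,x_n)-f(y_1,\dots,y_n)$ with $f$ a symmetric polynomial over $\mathbb Z$. A $k$-Bruhat transposition of $\sigma$ is a transposition $(a,b)$ with $a\le k<b$ and $\ell(\sigma\,(a,b))=\ell(\sigma)+1$. Let $W_{\sigma,k}=(\tau_1,\dots,\tau_m)$ be the list of all of them, in increasing order for $$(a,b)\prec(a',b')\iff \sigma(a)>\sigma(a')\ \text{ or }\ \bigl(a=a'\text{ and }\sigma(b)<\sigma(b')\bigr),$$ and let $\eta=\eta(\sigma,k)=\sigma\tau_1\tau_2\cdots\tau_m$. Then the coset $\sigma(\mathfrak S_k\times\mathfrak S_{n-k})$ has a greatest element $\zeta$ for the Bruhat order, $\sigma\le\eta$, and $$G_\sigma\,\frac{y_{\sigma_1}\cdots y_{\sigma_k}}{x_1\cdots x_k}\equiv G_\omega\,\hat\pi_{\omega\zeta}\,\pi_{\zeta^{-1}\sigma}\pmod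 I,\qquad G_\omega\,\hat\pi_{\omega\zeta}\,\pi_{\zeta^{-1}\sigma}=\sum_{\sigma\le\mu\le\eta}(-1)^{\ell(\mu)-\ell(\sigma)}G_\mu ,$$ the second being an equality in $L$. -/

import Mathlib

open scoped BigOperators

namespace GrothPieri

/-! ### The symmetric group: words, length, Bruhat order

`S_n` is `Equiv.Perm (Fin n)`; positions and values are numbered from `0`, and the product is
composition, so that `σ * swap a b` exchanges the entries of `σ` in positions `a` and `b`. -/

/-- The simple transposition exchanging the consecutive positions `i` and `i + 1`. -/
def simple {n : ℕ} (i : Fin (n - 1)) : Equiv.Perm (Fin n) :=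
  Equiv.swap ⟨i.val, by omega⟩ ⟨i.val + 1, by omega⟩

/-- The product `s_{i₁} ⋯ s_{iₘ}` of a word in the simple transpositions. -/
def wordProd {n : ℕ} (w : List (Fin (n - 1))) : Equiv.Perm (Fin n) :=
  (w.map simple).prod

/-- The length `ℓ(σ)`: the least size of a word in the simple transpositions with product `σ`. -/
noncomputable def len {n : ℕ} (σ : Equiv.Perm (Fin n)) : ℕ :=
  sInf {m | ∃ w : List (Fin (n - 1)), wordProd w = σ ∧ w.length = m}

theorem exists_word {n : ℕ} (σ : Equiv.Perm (Fin n)) :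
    ∃ w : List (Fin (n - 1)), wordProd w = σ := by
  cases n with
  | zero => exact ⟨[], Subsingleton.elim _ _⟩
  | succ m =>
    have h : σ ∈ Submonoid.closure
        (Set.range fun i : Fin m => Equiv.swap i.castSucc i.succ) := by
      rw [Equiv.Perm.mclosure_swap_castSucc_succ]; trivial
    induction h using Submonoid.closure_induction with
    | mem x hx =>
      obtain ⟨i, rfl⟩ := hx
      exact ⟨[i], by simp [wordProd, simple]; rfl⟩
    | one => exact ⟨[], rfl⟩
    | mul x y _ _ hx hy =>
      obtain ⟨u, rfl⟩ := hx
      obtain ⟨v, rfl⟩ := hy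
      exact ⟨u ++ v, by simp [wordProd]⟩

/-- `w` is a reduced decomposition of `σ`. -/
def IsReducedWord {n : ℕ} (w : List (Fin (n - 1))) (σ : Equiv.Perm (Fin n)) : Prop :=
  wordProd w = σ ∧ w.length = len σ

theorem exists_reducedWord {n : ℕ} (σ : Equiv.Perm (Fin n)) :
    ∃ w : List (Fin (n - 1)), IsReducedWord w σ := by
  obtain ⟨w, hw⟩ := exists_word σ
  exact Nat.sInf_mem (s := {m | ∃ w : List (Fin (n - 1)), wordProd w = σ ∧ w.length = m})
    ⟨_, w, hw, rfl⟩

/-- A reduced decomposition of `σ`, chosen once and for all. -/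
noncomputable def reducedWord {n : ℕ} (σ : Equiv.Perm (Fin n)) : List (Fin (n - 1)) :=
  Classical.choose (exists_reducedWord σ)

/-- `(a, b)` is a Bruhat transposition for `σ`: `a < b` and `σ (a, b)` covers `σ`. -/
def IsBruhatTransposition {n : ℕ} (σ : Equiv.Perm (Fin n)) (a b : Fin n) : Prop :=
  a < b ∧ len (σ * Equiv.swap a b) = len σ + 1

/-- The Bruhat order: the reflexive transitive closure of the covering relation. -/
def BruhatLE {n : ℕ} : Equiv.Perm (Fin n) → Equiv.Perm (Fin n) → Prop :=
  Relation.ReflTransGen fun σ μ =>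
    ∃ a b : Fin n, IsBruhatTransposition σ a b ∧ μ = σ * Equiv.swap a b

open Classical in
/-- The Bruhat interval `[σ, η]`, the set of all `μ` with `σ ≤ μ ≤ η`. -/
noncomputable def bruhatInterval {n : ℕ} (σ η : Equiv.Perm (Fin n)) :
    Finset (Equiv.Perm (Fin n)) :=
  Finset.univ.filter fun μ => BruhatLE σ μ ∧ BruhatLE μ η

/-- The maximal permutation `n, n - 1, …, 1`. -/
def omega (n : ℕ) : Equiv.Perm (Fin n) := Fin.revPerm

/-- The subgroup `S_k × S_{n-k}` of `S_n`: the permutations that preserve the set of the first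
`k` positions. -/
def youngSubgroup (n k : ℕ) : Subgroup (Equiv.Perm (Fin n)) where
  carrier := {τ | ∀ i, (τ i).val < k ↔ i.val < k}
  mul_mem' {a b} ha hb i := by
    rw [Equiv.Perm.mul_apply]
    exact (ha (b i)).trans (hb i)
  one_mem' i := Iff.rfl
  inv_mem' {a} ha i := by
    have h := ha (a⁻¹ i)
    have e : a (a⁻¹ i) = i := a.apply_symm_apply i
    rw [e] at h
    exact h.symm

/-- `ζ` is the maximal element, for the Bruhat order, of the coset `σ (S_k × S_{n-k})`. -/
def IsCosetMax {n : ℕ} (k : ℕ) (σ ζ : Equiv.Perm (Fin n)) : Prop :=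
  (∃ τ ∈ youngSubgroup n k, ζ = σ * τ) ∧ ∀ τ ∈ youngSubgroup n k, BruhatLE (σ * τ) ζ

/-! ### The list `W_{σ,k}` and the permutation `η(σ,k)` -/

/-- `(a, b)` is a `k`-Bruhat transposition for `σ`. With positions numbered from `1` the condition
on the positions reads `a ≤ k < b`. -/
def IsKBruhatTransposition {n : ℕ} (k : ℕ) (σ : Equiv.Perm (Fin n)) (p : Fin n × Fin n) : Prop :=
  p.1.val < k ∧ k ≤ p.2.val ∧ IsBruhatTransposition σ p.1 p.2

/-- The total order on the `k`-Bruhat transpositions of `σ`. -/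
def transpositionLT {n : ℕ} (σ : Equiv.Perm (Fin n)) (p q : Fin n × Fin n) : Prop :=
  σ q.1 < σ p.1 ∨ (p.1 = q.1 ∧ σ p.2 < σ q.2)

/-- All pairs of positions `(a, b)`, by decreasing `σ a`, then by increasing `σ b`. -/
def allPairs {n : ℕ} (σ : Equiv.Perm (Fin n)) : List (Fin n × Fin n) :=
  (List.finRange n).reverse.flatMap fun v =>
    (List.finRange n).map fun u => (σ.symm v, σ.symm u)

open Classical in
/-- The list `W_{σ,k}` of the `k`-Bruhat transpositions of `σ`, in increasing order. -/
noncomputable def W {n : ℕ} (k : ℕ) (σ : Equiv.Perm (Fin n)) : List (Fin n × Fin n) :=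
  (allPairs σ).filter fun p => decide (IsKBruhatTransposition k σ p)

theorem mem_W {n : ℕ} (k : ℕ) (σ : Equiv.Perm (Fin n)) (p : Fin n × Fin n) :
    p ∈ W k σ ↔ IsKBruhatTransposition k σ p := by
  have h : p ∈ allPairs σ := by
    simp only [allPairs, List.mem_flatMap, List.mem_map]
    exact ⟨σ p.1, by simp, σ p.2, by simp, by simp⟩
  simp [W, h]

theorem W_sorted {n : ℕ} (k : ℕ) (σ : Equiv.Perm (Fin n)) :
    (W k σ).Pairwise (transpositionLT σ) := by
  refine List.Pairwise.filter _ ?_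
  rw [allPairs, List.pairwise_flatMap]
  constructor
  · intro v _
    rw [List.pairwise_map]
    exact (List.pairwise_lt_finRange n).imp fun h => Or.inr ⟨rfl, by simpa using h⟩
  · rw [List.pairwise_reverse]
    refine (List.pairwise_lt_finRange n).imp fun h => ?_
    simp only [List.mem_map]
    rintro _ ⟨u, _, rfl⟩ _ ⟨u', _, rfl⟩
    exact Or.inl (by simpa using h)

/-- `η(σ,k) = σ W_{σ,k} = σ τ₁ τ₂ ⋯ τₘ`, where `W_{σ,k} = (τ₁, …, τₘ)`. -/
noncomputable def eta {n : ℕ} (k : ℕ) (σ : Equiv.Perm (Fin n)) : Equiv.Perm (Fin n) :=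
  σ * ((W k σ).map fun p => Equiv.swap p.1 p.2).prod

/-! ### Laurent polynomials in `x₁, …, xₙ, y₁, …, yₙ` and divided differences -/

/-- Rational functions in the variables `xᵢ` (left summand) and `yⱼ` (right summand). -/
abbrev RatFun (n : ℕ) : Type := FractionRing (MvPolynomial (Fin n ⊕ Fin n) ℤ)

noncomputable def ratX {n : ℕ} (i : Fin n) : RatFun n :=
  algebraMap (MvPolynomial (Fin n ⊕ Fin n) ℤ) (RatFun n) (MvPolynomial.X (Sum.inl i))

noncomputable def ratY {n : ℕ} (i : Fin n) : RatFun n :=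
  algebraMap (MvPolynomial (Fin n ⊕ Fin n) ℤ) (RatFun n) (MvPolynomial.X (Sum.inr i))

/-- The ring `ℤ[x₁^±¹, …, xₙ^±¹, y₁^±¹, …, yₙ^±¹]`. -/
noncomputable def Laurent (n : ℕ) : Subalgebra ℤ (RatFun n) :=
  Algebra.adjoin ℤ (Set.range ratX ∪ Set.range (fun i => (ratX i)⁻¹) ∪
    Set.range ratY ∪ Set.range (fun i => (ratY i)⁻¹))

theorem ratX_mem {n : ℕ} (i : Fin n) : ratX i ∈ Laurent n :=
  Algebra.subset_adjoin (Or.inl (Or.inl (Or.inl ⟨i, rfl⟩)))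

theorem ratX_inv_mem {n : ℕ} (i : Fin n) : (ratX i)⁻¹ ∈ Laurent n :=
  Algebra.subset_adjoin (Or.inl (Or.inl (Or.inr ⟨i, rfl⟩)))

theorem ratY_mem {n : ℕ} (i : Fin n) : ratY i ∈ Laurent n :=
  Algebra.subset_adjoin (Or.inl (Or.inr ⟨i, rfl⟩))

theorem ratY_inv_mem {n : ℕ} (i : Fin n) : (ratY i)⁻¹ ∈ Laurent n :=
  Algebra.subset_adjoin (Or.inr ⟨i, rfl⟩)

/-- The variable `xᵢ`. -/
noncomputable def x {n : ℕ} (i : Fin n) : Laurent n := ⟨ratX i, ratX_mem i⟩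

/-- The inverse `1 / xᵢ`. -/
noncomputable def xInv {n : ℕ} (i : Fin n) : Laurent n := ⟨(ratX i)⁻¹, ratX_inv_mem i⟩

/-- The variable `yᵢ`. -/
noncomputable def y {n : ℕ} (i : Fin n) : Laurent n := ⟨ratY i, ratY_mem i⟩

/-- The action of a permutation on the variables `xᵢ`, the `yⱼ` being fixed. -/
noncomputable def permX {n : ℕ} (τ : Equiv.Perm (Fin n)) : RatFun n ≃+* RatFun n :=
  IsFractionRing.ringEquivOfRingEquiv
    (MvPolynomial.renameEquiv ℤ (Equiv.sumCongr τ (Equiv.refl (Fin n)))).toRingEquiv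

theorem permX_ratX {n : ℕ} (τ : Equiv.Perm (Fin n)) (i : Fin n) :
    permX τ (ratX i) = ratX (τ i) := by
  simp [permX, ratX]

theorem permX_ratY {n : ℕ} (τ : Equiv.Perm (Fin n)) (i : Fin n) :
    permX τ (ratY i) = ratY i := by
  simp [permX, ratY]

theorem ratX_ne_zero {n : ℕ} (i : Fin n) : ratX i ≠ 0 := by
  rw [ratX, Ne, FaithfulSMul.algebraMap_eq_zero_iff]
  exact MvPolynomial.X_ne_zero _

theorem ratX_injective {n : ℕ} : Function.Injective (ratX (n := n)) := by
  intro i j h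
  exact Sum.inl_injective (MvPolynomial.X_injective (IsFractionRing.injective _ _ h))

/-- The divided difference `∂ᵢ` on rational functions, `f ↦ (f - f sᵢ) / (xᵢ - xᵢ₊₁)`. -/
noncomputable def ratDiv {n : ℕ} (i : Fin (n - 1)) (f : RatFun n) : RatFun n :=
  (f - permX (simple i) f) / (ratX ⟨i.val, by omega⟩ - ratX ⟨i.val + 1, by omega⟩)

theorem permX_mem {n : ℕ} (τ : Equiv.Perm (Fin n)) {f : RatFun n} (hf : f ∈ Laurent n) :
    permX τ f ∈ Laurent n := by
  induction hf using Algebra.adjoin_induction with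
  | mem f hf =>
    rcases hf with ((⟨j, rfl⟩ | ⟨j, rfl⟩) | ⟨j, rfl⟩) | ⟨j, rfl⟩
    · rw [permX_ratX]; exact ratX_mem _
    · simp only [map_inv₀, permX_ratX]; exact ratX_inv_mem _
    · rw [permX_ratY]; exact ratY_mem _
    · simp only [map_inv₀, permX_ratY]; exact ratY_inv_mem _
  | algebraMap r => simp
  | add f g _ _ hf hg => rw [map_add]; exact add_mem hf hg
  | mul f g _ _ hf hg => rw [map_mul]; exact mul_mem hf hg

theorem ratDiv_mem {n : ℕ} (i : Fin (n - 1)) {f : RatFun n} (hf : f ∈ Laurent n) :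
    ratDiv i f ∈ Laurent n := by
  have hne : ratX (n := n) ⟨i.val, by omega⟩ - ratX ⟨i.val + 1, by omega⟩ ≠ 0 := by
    rw [sub_ne_zero]
    intro h
    have := congrArg Fin.val (ratX_injective h)
    simp at this
  have hX : ∀ j : Fin n, ratDiv i (ratX j) ∈ Laurent n := by
    intro j
    rw [ratDiv, permX_ratX]
    by_cases h1 : j = ⟨i.val, by omega⟩
    · subst h1
      rw [simple, Equiv.swap_apply_left, div_self hne]
      exact one_mem _
    by_cases h2 : j = ⟨i.val + 1, by omega⟩
    · subst h2
      rw [simple, Equiv.swap_apply_right, ← neg_sub, neg_div, div_self hne]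
      exact neg_mem (one_mem _)
    · rw [simple, Equiv.swap_apply_of_ne_of_ne h1 h2]
      simp
  induction hf using Algebra.adjoin_induction with
  | mem f hf =>
    rcases hf with ((⟨j, rfl⟩ | ⟨j, rfl⟩) | ⟨j, rfl⟩) | ⟨j, rfl⟩
    · exact hX j
    · have h : ratDiv i (ratX j)⁻¹ =
          -(ratDiv i (ratX j) * (ratX j)⁻¹ * (ratX (simple i j))⁻¹) := by
        have h1 := ratX_ne_zero j
        have h2 := ratX_ne_zero (simple i j)
        simp only [ratDiv, map_inv₀, permX_ratX]
        field_simp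
        ring
      simp only [h]
      exact neg_mem (mul_mem (mul_mem (hX j) (ratX_inv_mem _)) (ratX_inv_mem _))
    · simp [ratDiv, permX_ratY]
    · simp [ratDiv, permX_ratY]
  | algebraMap r => simp [ratDiv]
  | add f g _ _ hf hg =>
    have h : ratDiv i (f + g) = ratDiv i f + ratDiv i g := by
      simp only [ratDiv, map_add]; ring
    rw [h]; exact add_mem hf hg
  | mul f g hf' hg' hf hg =>
    have h : ratDiv i (f * g) = ratDiv i f * g + permX (simple i) f * ratDiv i g := by
      simp only [ratDiv, map_mul]; ring
    rw [h]; exact add_mem (mul_mem hf hg') (mul_mem (permX_mem _ hf') hg)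

/-- The divided difference `∂ᵢ` on Laurent polynomials. -/
noncomputable def divDiff {n : ℕ} (i : Fin (n - 1)) (f : Laurent n) : Laurent n :=
  ⟨ratDiv i f, ratDiv_mem i f.2⟩

/-- The isobaric divided difference `f πᵢ = (xᵢ f - xᵢ₊₁ (f sᵢ)) / (xᵢ - xᵢ₊₁) = (xᵢ f) ∂ᵢ`. -/
noncomputable def piOp {n : ℕ} (i : Fin (n - 1)) (f : Laurent n) : Laurent n :=
  divDiff i (x ⟨i.val, by omega⟩ * f)

/-- The isobaric divided difference `f π̂ᵢ = xᵢ₊₁ (f - f sᵢ) / (xᵢ - xᵢ₊₁) = xᵢ₊₁ (f ∂ᵢ)`. -/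
noncomputable def hatPiOp {n : ℕ} (i : Fin (n - 1)) (f : Laurent n) : Laurent n :=
  x ⟨i.val + 1, by omega⟩ * divDiff i f

/-- `f π_σ = f π_{i₁} ⋯ π_{iₘ}` for a reduced decomposition `s_{i₁} ⋯ s_{iₘ}` of `σ`. The operators
act on the right, so that `π_{i₁}` is applied first. As the `πᵢ` satisfy the braid relations, the
result does not depend on the reduced decomposition. -/
noncomputable def piPerm {n : ℕ} (σ : Equiv.Perm (Fin n)) (f : Laurent n) : Laurent n :=
  (reducedWord σ).foldl (fun g i => piOp i g) f

/-- `f π̂_σ = f π̂_{i₁} ⋯ π̂_{iₘ}` for a reduced decomposition `s_{i₁} ⋯ s_{iₘ}` of `σ`. -/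
noncomputable def hatPiPerm {n : ℕ} (σ : Equiv.Perm (Fin n)) (f : Laurent n) : Laurent n :=
  (reducedWord σ).foldl (fun g i => hatPiOp i g) f

/-! ### Grothendieck polynomials -/

/-- The dominant double Grothendieck polynomial `G_ω = ∏_{i + j ≤ n} (1 - yⱼ / xᵢ)` (with indices
from `1`; from `0`, the condition reads `i + j + 1 < n`). -/
noncomputable def grothOmega (n : ℕ) : Laurent n :=
  ∏ i : Fin n, ∏ j : Fin n, if i.val + j.val + 1 < n then 1 - y j * xInv i else 1

/-- The double Grothendieck polynomial `G_σ`, reached from `G_ω` by `G_{μ sᵢ} = G_μ πᵢ` whenever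
`μ(i) > μ(i+1)`; that is `G_σ = G_ω π_{ωσ}`. -/
noncomputable def groth {n : ℕ} (σ : Equiv.Perm (Fin n)) : Laurent n :=
  piPerm (omega n * σ) (grothOmega n)

/-- The ideal that identifies each symmetric function of the `xᵢ` with the same symmetric function
of the `yᵢ`. -/
noncomputable def symIdeal (n : ℕ) : Ideal (Laurent n) :=
  Ideal.span {h | ∃ f : MvPolynomial (Fin n) ℤ, f.IsSymmetric ∧
    h = MvPolynomial.aeval (x (n := n)) f - MvPolynomial.aeval (y (n := n)) f}

end GrothPieri

open GrothPieri

/-!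
Let `ζ` be the element of `σ (S_k × S_{n-k})` whose entries decrease on both blocks of positions.

*The congruence.* The ideal identifies `∏ (X - xᵢ)` with `∏ (X - yᵢ)`, and this makes the staircase
product satisfy `G_ω y_{n+1-i} / xᵢ ≡ G_ω`. Divided differences in the `y` variables multiply the
index of `G` by `sⱼ` on the left and descend to the quotient; going down from `ω` to `ζ` they give
`G_ζ (y_{ζ₁} ⋯ y_{ζ_k}) / (x₁ ⋯ x_k) ≡ ∑_{μ ≥ ζ} (-1)^{ℓ(μ) - ℓ(ζ)} G_μ`, whose right-hand side is
`G_ω π̂_{ωζ}`. The monomial is fixed by `S_k × S_{n-k}` acting on the `x` variables, so applying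
`π_{ζ⁻¹σ}` to both sides gives the congruence for `σ`.

*The expansion.* Each `πᵢ` either sends `G_μ` to `G_{μ sᵢ}` or fixes it, so in a signed sum over a
set of permutations it cancels the pairs `{μ, μ sᵢ}` contained in the set. Following `{μ | ζ ≤ μ}`
along a reduced word of `ζ⁻¹σ` leaves the set of all `μ` whose entries satisfy, position by
position, a condition relative to `σ`. Putting the entries `σ₁, …, σ_k` back in place, the
smallest first, shows that this set has the greatest element `η` and is the Bruhat interval from `σ`
to `η`.
-/

namespace GrothPieri

open Equiv Finset

variable {n : ℕ}

/-! ### Inversions and length -/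

/-- The left position exchanged by `simple i`. -/
def lo (i : Fin (n - 1)) : Fin n := ⟨i.val, by omega⟩

/-- The right position exchanged by `simple i`. -/
def hi (i : Fin (n - 1)) : Fin n := ⟨i.val + 1, by omega⟩

@[simp] theorem lo_val (i : Fin (n - 1)) : (lo i).val = i.val := rfl

@[simp] theorem hi_val (i : Fin (n - 1)) : (hi i).val = i.val + 1 := rfl

theorem lo_lt_hi (i : Fin (n - 1)) : lo i < hi i := Nat.lt_succ_self _

theorem lo_ne_hi (i : Fin (n - 1)) : lo i ≠ hi i := (lo_lt_hi i).ne

theorem simple_eq_swap (i : Fin (n - 1)) : simple i = swap (lo i) (hi i) := rfl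

@[simp] theorem simple_lo (i : Fin (n - 1)) : simple i (lo i) = hi i := swap_apply_left _ _

@[simp] theorem simple_hi (i : Fin (n - 1)) : simple i (hi i) = lo i := swap_apply_right _ _

theorem simple_apply_of_ne {i : Fin (n - 1)} {c : Fin n} (hlo : c ≠ lo i) (hhi : c ≠ hi i) :
    simple i c = c := swap_apply_of_ne_of_ne hlo hhi

@[simp] theorem simple_simple (i : Fin (n - 1)) (c : Fin n) : simple i (simple i c) = c :=
  swap_apply_self _ _ _

@[simp] theorem simple_mul_self (i : Fin (n - 1)) : simple i * simple i = 1 := swap_mul_self _ _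

@[simp] theorem simple_symm (i : Fin (n - 1)) : (simple i).symm = simple i := symm_swap _ _

@[simp] theorem simple_inv (i : Fin (n - 1)) : (simple i)⁻¹ = simple i := swap_inv _ _

@[simp] theorem mul_simple_mul_simple (w : Perm (Fin n)) (i : Fin (n - 1)) :
    w * simple i * simple i = w := by
  rw [mul_assoc, simple_mul_self, mul_one]

theorem mul_simple_apply_of_ne {w : Perm (Fin n)} {i : Fin (n - 1)} {c : Fin n} (hlo : c ≠ lo i)
    (hhi : c ≠ hi i) : (w * simple i) c = w c := by
  rw [Perm.mul_apply, simple_apply_of_ne hlo hhi]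

theorem ascent_or_descent (w : Perm (Fin n)) (i : Fin (n - 1)) :
    w (lo i) < w (hi i) ∨ w (hi i) < w (lo i) :=
  lt_or_gt_of_ne fun h => lo_ne_hi i (w.injective h)

theorem simple_lt_simple {i : Fin (n - 1)} {a b : Fin n} (hab : a < b)
    (h : ¬ (a = lo i ∧ b = hi i)) : simple i a < simple i b := by
  simp only [simple_eq_swap, swap_apply_def]
  split_ifs <;> simp only [Fin.lt_def, Fin.ext_iff, lo_val, hi_val] at * <;> omega

/-- The inversions of `w`: pairs of positions `a < b` with `w b < w a`. -/
def inversions (w : Perm (Fin n)) : Finset (Fin n × Fin n) :=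
  {p | p.1 < p.2 ∧ w p.2 < w p.1}

theorem mem_inversions {w : Perm (Fin n)} {p : Fin n × Fin n} :
    p ∈ inversions w ↔ p.1 < p.2 ∧ w p.2 < w p.1 := by
  simp [inversions]

theorem inversions_one : inversions (1 : Perm (Fin n)) = ∅ := by
  refine eq_empty_of_forall_notMem fun p hp => ?_
  exact lt_asymm (mem_inversions.1 hp).1 (mem_inversions.1 hp).2

theorem inversions_mul_simple {w : Perm (Fin n)} {i : Fin (n - 1)} (h : w (lo i) < w (hi i)) :
    inversions (w * simple i) =
      insert (lo i, hi i) ((inversions w).map ((simple i).prodCongr (simple i)).toEmbedding) := by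
  have simple_lt_iff : ∀ a b : Fin n, ¬ (a = lo i ∧ b = hi i) → ¬ (a = hi i ∧ b = lo i) →
      (simple i a < simple i b ↔ a < b) := fun a b hlohi hhilo => by
    refine ⟨fun hab => ?_, fun hab => simple_lt_simple hab hlohi⟩
    have hne : ¬ (simple i a = lo i ∧ simple i b = hi i) := fun h =>
      hhilo ⟨by rw [← simple_simple i a, h.1, simple_lo],
        by rw [← simple_simple i b, h.2, simple_hi]⟩
    simpa using simple_lt_simple hab hne
  ext ⟨a, b⟩
  simp only [mem_insert, mem_map_equiv, mem_inversions, Perm.mul_apply, Prod.mk.injEq,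
    prodCongr_symm, prodCongr_apply, Prod.map_apply, simple_symm]
  by_cases hlohi : a = lo i ∧ b = hi i
  · simp [hlohi.1, hlohi.2, h, lo_lt_hi]
  by_cases hhilo : a = hi i ∧ b = lo i
  · simp [hhilo.1, hhilo.2, h.not_gt, (lo_lt_hi i).not_gt, lo_ne_hi]
  · simp [hlohi, simple_lt_iff a b hlohi hhilo]

theorem card_inversions_mul_simple {w : Perm (Fin n)} {i : Fin (n - 1)}
    (h : w (lo i) < w (hi i)) : #(inversions (w * simple i)) = #(inversions w) + 1 := by
  rw [inversions_mul_simple h, card_insert_of_notMem, card_map]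
  simp [simple_eq_swap, mem_inversions, (lo_lt_hi i).not_gt]

theorem card_inversions_of_descent {w : Perm (Fin n)} {i : Fin (n - 1)}
    (h : w (hi i) < w (lo i)) : #(inversions (w * simple i)) + 1 = #(inversions w) := by
  simpa using (card_inversions_mul_simple (w := w * simple i) (i := i) (by simpa using h)).symm

theorem wordProd_append_singleton (l : List (Fin (n - 1))) (i : Fin (n - 1)) :
    wordProd (l ++ [i]) = wordProd l * simple i := by
  simp [wordProd]

theorem card_inversions_wordProd_le (l : List (Fin (n - 1))) :
    #(inversions (wordProd l)) ≤ l.length := by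
  induction l using List.reverseRecOn with
  | nil => simp [wordProd, inversions_one]
  | append_singleton l i ih =>
    rw [wordProd_append_singleton, List.length_append, List.length_singleton]
    rcases ascent_or_descent (wordProd l) i with h | h
    · have := card_inversions_mul_simple h
      omega
    · have := card_inversions_of_descent h
      omega

theorem eq_one_of_no_descent {w : Perm (Fin n)} (h : ∀ i, w (lo i) < w (hi i)) : w = 1 := by
  have hw : StrictMono w := by
    cases n with
    | zero => exact fun a => a.elim0
    | succ m => exact Fin.strictMono_iff_lt_succ.2 h
  have hrefl : hw.orderIsoOfSurjective w w.surjective = OrderIso.refl _ := Subsingleton.elim _ _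
  exact Equiv.ext fun c => DFunLike.congr_fun hrefl c

theorem exists_word_length_eq_card_inversions (w : Perm (Fin n)) :
    ∃ l : List (Fin (n - 1)), wordProd l = w ∧ l.length = #(inversions w) := by
  generalize hm : #(inversions w) = m
  induction m generalizing w with
  | zero =>
    refine ⟨[], (eq_one_of_no_descent fun i => ?_).symm, rfl⟩
    refine (ascent_or_descent w i).resolve_right fun h => ?_
    have := card_inversions_of_descent h
    omega
  | succ m ih =>
    obtain ⟨i, hd⟩ : ∃ i, w (hi i) < w (lo i) := by
      by_contra! hasc
      have hone : w = 1 := eq_one_of_no_descent fun i =>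
        (ascent_or_descent w i).resolve_right (hasc i).not_gt
      simp [hone, inversions_one] at hm
    have := card_inversions_of_descent hd
    obtain ⟨l, hl, hlen⟩ := ih (w * simple i) (by omega)
    exact ⟨l ++ [i], by rw [wordProd_append_singleton, hl, mul_simple_mul_simple], by simp [hlen]⟩

theorem len_eq_card_inversions (w : Perm (Fin n)) : len w = #(inversions w) := by
  apply le_antisymm
  · exact Nat.sInf_le (exists_word_length_eq_card_inversions w)
  · obtain ⟨l, hl, hlen⟩ := exists_reducedWord w
    rw [← hlen, ← hl]
    exact card_inversions_wordProd_le l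

theorem len_wordProd_le (l : List (Fin (n - 1))) : len (wordProd l) ≤ l.length :=
  Nat.sInf_le ⟨l, rfl, rfl⟩

theorem len_mul_simple_of_ascent {w : Perm (Fin n)} {i : Fin (n - 1)} (h : w (lo i) < w (hi i)) :
    len (w * simple i) = len w + 1 := by
  rw [len_eq_card_inversions, len_eq_card_inversions, card_inversions_mul_simple h]

theorem len_mul_simple_of_descent {w : Perm (Fin n)} {i : Fin (n - 1)} (h : w (hi i) < w (lo i)) :
    len (w * simple i) + 1 = len w := by
  rw [len_eq_card_inversions, len_eq_card_inversions, card_inversions_of_descent h]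

@[simp] theorem len_one : len (1 : Perm (Fin n)) = 0 := by
  rw [len_eq_card_inversions, inversions_one, card_empty]

theorem len_inv (w : Perm (Fin n)) : len w⁻¹ = len w := by
  rw [len_eq_card_inversions, len_eq_card_inversions]
  refine card_nbij' (fun p => (w⁻¹ p.2, w⁻¹ p.1)) (fun p => (w p.2, w p.1)) ?_ ?_ ?_ ?_ <;>
    rintro ⟨a, b⟩ h <;> simp_all [mem_inversions]

theorem len_simple_mul_of_ascent {w : Perm (Fin n)} {i : Fin (n - 1)}
    (h : w⁻¹ (lo i) < w⁻¹ (hi i)) : len (simple i * w) = len w + 1 := by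
  rw [← len_inv, mul_inv_rev, simple_inv, len_mul_simple_of_ascent h, len_inv]

theorem len_le_mul_self (w : Perm (Fin n)) : len w ≤ n * n := by
  rw [len_eq_card_inversions]
  exact (card_le_univ _).trans_eq (by simp)

theorem isReducedWord_reducedWord (w : Perm (Fin n)) : IsReducedWord (reducedWord w) w :=
  Classical.choose_spec (exists_reducedWord w)

theorem reducedWord_one : reducedWord (1 : Perm (Fin n)) = [] :=
  List.length_eq_zero_iff.1 ((isReducedWord_reducedWord 1).2.trans len_one)

theorem IsReducedWord.append_singleton {l : List (Fin (n - 1))} {w : Perm (Fin n)}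
    {i : Fin (n - 1)} (hl : IsReducedWord l w) (h : w (lo i) < w (hi i)) :
    IsReducedWord (l ++ [i]) (w * simple i) :=
  ⟨by rw [wordProd_append_singleton, hl.1], by simp [len_mul_simple_of_ascent h, hl.2]⟩

theorem IsReducedWord.of_append_singleton {l : List (Fin (n - 1))} {w : Perm (Fin n)}
    {i : Fin (n - 1)} (hl : IsReducedWord (l ++ [i]) w) :
    w (hi i) < w (lo i) ∧ IsReducedWord l (w * simple i) := by
  have hprod : wordProd l = w * simple i := by
    rw [← hl.1, wordProd_append_singleton, mul_simple_mul_simple]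
  have hlen : l.length + 1 = len w := by simpa using hl.2
  have hle : len (w * simple i) ≤ l.length := hprod ▸ len_wordProd_le l
  rcases ascent_or_descent w i with h | h
  · have := len_mul_simple_of_ascent h
    omega
  · have := len_mul_simple_of_descent h
    exact ⟨h, hprod, by omega⟩

theorem IsReducedWord.cons {l : List (Fin (n - 1))} {w : Perm (Fin n)} {i : Fin (n - 1)}
    (hl : IsReducedWord l w) (h : w⁻¹ (lo i) < w⁻¹ (hi i)) :
    IsReducedWord (i :: l) (simple i * w) :=
  ⟨by simp [← hl.1, wordProd], by simp [len_simple_mul_of_ascent h, hl.2]⟩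

theorem exists_hi_eq {a b : Fin n} (hab : a < b) : ∃ i : Fin (n - 1), a ≤ lo i ∧ hi i = b :=
  ⟨⟨b.val - 1, by omega⟩, by simp only [Fin.le_def, lo_val]; omega,
    Fin.ext (by simp only [hi_val]; omega)⟩

theorem swap_eq_simple_conj {i : Fin (n - 1)} {a : Fin n} (ha : a < lo i) :
    swap a (hi i) = simple i * swap a (lo i) * simple i := by
  rw [simple_eq_swap, swap_mul_swap_mul_swap ha.ne (ha.trans (lo_lt_hi i)).ne, swap_comm]

-- Conjugating `swap a b` by the simple transposition at its right end moves that end one position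
-- to the left, while the length changes by `1` in a direction dictated by the cover condition.
theorem len_mul_swap_of_cover {w : Perm (Fin n)} {a b : Fin n} (hab : a < b) (hw : w a < w b)
    (hc : ∀ c, a < c → c < b → ¬ (w a < w c ∧ w c < w b)) :
    len (w * swap a b) = len w + 1 := by
  generalize hm : b.val = m
  induction m generalizing w b with
  | zero => omega
  | succ m ih =>
    obtain ⟨i, hai, rfl⟩ := exists_hi_eq hab
    rcases hai.eq_or_lt with rfl | hai
    · exact len_mul_simple_of_ascent hw
    have ha : (w * simple i) a = w a := mul_simple_apply_of_ne hai.ne hab.ne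
    have hcover : len (w * simple i * swap a (lo i)) = len (w * simple i) + 1 := by
      refine ih hai (by simpa [ha] using hw) (fun c hac hci => ?_) (by simpa using hm)
      have hci' : c < hi i := hci.trans (lo_lt_hi i)
      simpa [ha, mul_simple_apply_of_ne hci.ne hci'.ne] using hc c hac hci'
    have hlo : (w * simple i * swap a (lo i)) (lo i) = w a := by simp [← ha]
    have hhi : (w * simple i * swap a (lo i)) (hi i) = w (lo i) := by
      simp [swap_apply_of_ne_of_ne hab.ne' (lo_ne_hi i).symm]
    rw [swap_eq_simple_conj hai, ← mul_assoc, ← mul_assoc]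
    have hne : w (lo i) ≠ w a := fun h => hai.ne' (w.injective h)
    rcases lt_or_gt_of_ne hne with hlt | hgt
    · have := len_mul_simple_of_ascent (hlt.trans hw)
      have := len_mul_simple_of_descent (hlo ▸ hhi ▸ hlt)
      omega
    · have hdesc := (ascent_or_descent w i).resolve_left fun h => hc _ hai (lo_lt_hi i) ⟨hgt, h⟩
      have := len_mul_simple_of_descent hdesc
      have := len_mul_simple_of_ascent (hlo ▸ hhi ▸ hgt)
      omega

/-! ### Rank functions and the Bruhat order -/

theorem card_filter_eq_add {α : Type*} [Fintype α] {P Q R : α → Prop} [DecidablePred P]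
    [DecidablePred Q] [DecidablePred R] (h : ∀ c, P c ↔ Q c ∨ R c) (hQR : ∀ c, Q c → ¬ R c) :
    #{c | P c} = #{c | Q c} + #{c | R c} := by
  classical
  rw [← card_union_of_disjoint (disjoint_filter.2 fun c _ => hQR c), ← filter_or]
  simp only [h]

/-- The rank function of `w`: the number of positions before `p` whose entry is at least `q`. -/
def rk (w : Perm (Fin n)) (p q : ℕ) : ℕ := #{c : Fin n | c.val < p ∧ q ≤ (w c).val}

/-- The pointwise order on rank functions. By the tableau criterion it is the Bruhat order. -/
def RkLE (w u : Perm (Fin n)) : Prop := ∀ p q, rk w p q ≤ rk u p q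

theorem RkLE.refl (w : Perm (Fin n)) : RkLE w w := fun _ _ => le_rfl

theorem RkLE.trans {u v w : Perm (Fin n)} (huv : RkLE u v) (hvw : RkLE v w) : RkLE u w :=
  fun p q => (huv p q).trans (hvw p q)

theorem rk_zero (w : Perm (Fin n)) (q : ℕ) : rk w 0 q = 0 := by simp [rk]

theorem rk_succ (w : Perm (Fin n)) (c : Fin n) (q : ℕ) :
    rk w (c.val + 1) q = rk w c.val q + if q ≤ (w c).val then 1 else 0 := by
  have hcard : #{d : Fin n | d = c ∧ q ≤ (w d).val} = if q ≤ (w c).val then 1 else 0 := by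
    simp only [filter_and, filter_eq', mem_univ, if_true]
    split_ifs <;> simp [*]
  rw [← hcard]
  refine card_filter_eq_add (fun d => ?_) fun d => ?_ <;> rw [Fin.ext_iff] <;> omega

theorem rk_of_le (w u : Perm (Fin n)) {p : ℕ} (hp : n ≤ p) (q : ℕ) : rk w p q = rk u p q := by
  refine card_nbij' (fun c => u⁻¹ (w c)) (fun c => w⁻¹ (u c)) ?_ ?_ ?_ ?_ <;>
    intro c hc <;> simp_all <;> omega

theorem rk_congr_of_lt {w u : Perm (Fin n)} {m : ℕ} (h : ∀ c : Fin n, c.val < m → w c = u c)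
    {p : ℕ} (hp : p ≤ m) (q : ℕ) : rk w p q = rk u p q := by
  refine congrArg card (filter_congr fun c _ => and_congr_right fun hc => ?_)
  rw [h c (by omega)]

theorem rk_mul_swap {w : Perm (Fin n)} {a b : Fin n} (hab : a < b) (hw : w a < w b) (p q : ℕ) :
    rk (w * swap a b) p q =
      rk w p q + if a.val < p ∧ p ≤ b.val ∧ (w a).val < q ∧ q ≤ (w b).val then 1 else 0 := by
  rcases le_or_gt p n with hp | hp
  · induction p with
    | zero => simp [rk_zero]
    | succ p ih =>
      have hw := rk_succ w ⟨p, hp⟩ q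
      have hw' := rk_succ (w * swap a b) ⟨p, hp⟩ q
      simp only [Perm.mul_apply, swap_apply_def, Fin.ext_iff] at hw hw'
      rw [hw, hw', ih (by omega)]
      grind
  · rw [rk_of_le _ w hp.le, if_neg (by omega), add_zero]

theorem rk_eq_rk_mul_swap_add {w : Perm (Fin n)} {a b : Fin n} (hab : a < b) (hw : w b < w a)
    (p q : ℕ) : rk w p q = rk (w * swap a b) p q +
      if a.val < p ∧ p ≤ b.val ∧ (w b).val < q ∧ q ≤ (w a).val then 1 else 0 := by
  simpa using rk_mul_swap (w := w * swap a b) hab (by simpa using hw) p q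

theorem rkLE_mul_swap {w : Perm (Fin n)} {a b : Fin n} (hab : a < b) (hw : w a < w b) :
    RkLE w (w * swap a b) := fun p q => by
  rw [rk_mul_swap hab hw]
  exact Nat.le_add_right _ _

theorem rk_eq_rk_add_card_window (w : Perm (Fin n)) (p : ℕ) {q q' : ℕ} (hq : q ≤ q') :
    rk w p q = rk w p q' + #{c : Fin n | c.val < p ∧ q ≤ (w c).val ∧ (w c).val < q'} :=
  card_filter_eq_add (fun c => by omega) fun c => by omega

theorem rk_eq_rk_add_card_segment (w : Perm (Fin n)) {p p' : ℕ} (hp : p ≤ p') (q : ℕ) :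
    rk w p' q = rk w p q + #{c : Fin n | p ≤ c.val ∧ c.val < p' ∧ q ≤ (w c).val} :=
  card_filter_eq_add (fun c => by omega) fun c => by omega

theorem rk_lt_of_window {w u : Perm (Fin n)} {p p' q q' : ℕ} (hq : q ≤ q')
    (hle : rk w p q' ≤ rk u p q')
    (hwindow : ∀ c : Fin n, c.val < p → q ≤ (w c).val → (w c).val < q' → c.val < p')
    (heq : ∀ c : Fin n, c.val < p' → u c = w c)
    (hnew : ∃ c : Fin n, p' ≤ c.val ∧ c.val < p ∧ q ≤ (u c).val ∧ (u c).val < q') :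
    rk w p q < rk u p q := by
  rw [rk_eq_rk_add_card_window w p hq, rk_eq_rk_add_card_window u p hq]
  refine add_lt_add_of_le_of_lt hle (card_lt_card ?_)
  rw [ssubset_iff_of_subset]
  · obtain ⟨c, hp'c, hcp, hqc, hcq'⟩ := hnew
    refine ⟨c, mem_filter.2 ⟨mem_univ c, hcp, hqc, hcq'⟩, fun hc => ?_⟩
    obtain ⟨-, hcp, hqc, hcq'⟩ := mem_filter.1 hc
    exact hp'c.not_gt (hwindow c hcp hqc hcq')
  · intro c hc
    obtain ⟨-, hcp, hqc, hcq'⟩ := mem_filter.1 hc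
    exact mem_filter.2 ⟨mem_univ c, by rw [heq c (hwindow c hcp hqc hcq')]; exact ⟨hcp, hqc, hcq'⟩⟩

theorem RkLE.exists_first_lt {w u : Perm (Fin n)} (h : RkLE w u) (hne : w ≠ u) :
    ∃ a, (∀ c, c < a → w c = u c) ∧ w a < u a := by
  obtain ⟨a, hwua, hmin⟩ := WellFounded.has_min (wellFounded_lt (α := Fin n)) {c | w c ≠ u c}
    (not_forall.1 fun heq => hne (Equiv.ext heq))
  have heq : ∀ c, c < a → w c = u c := fun c hc => not_not.1 fun hwuc => hmin c hwuc hc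
  refine ⟨a, heq, lt_of_le_of_ne ?_ hwua⟩
  have hrk := h (a + 1) (w a)
  rw [rk_succ, rk_succ, rk_congr_of_lt heq le_rfl, if_pos le_rfl] at hrk
  by_contra hlt
  rw [if_neg (Fin.le_def.not.1 hlt)] at hrk
  omega

theorem exists_cover_toward {w : Perm (Fin n)} {a v : Fin n} (hav : w a < v)
    (hv : a < w.symm v) : ∃ b, a < b ∧ w a < w b ∧ w b ≤ v ∧
      ∀ c, a < c → c < b → ¬ (w a < w c ∧ w c ≤ v) := by
  obtain ⟨b, ⟨hab, hwab, hbv⟩, hmin⟩ := WellFounded.has_min (wellFounded_lt (α := Fin n))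
    {b | a < b ∧ w a < w b ∧ w b ≤ v} ⟨w.symm v, hv, by simpa using hav, by simp⟩
  exact ⟨b, hab, hwab, hbv, fun c hac hcb hc => hmin c ⟨hac, hc⟩ hcb⟩

-- `a` is the first position where `w` and `u` differ and `b` the next one whose entry lies in
-- `(w a, u a]`; between them `w` has no entry of that range, so `u` keeps dominating.
theorem RkLE.exists_cover {w u : Perm (Fin n)} (h : RkLE w u) (hne : w ≠ u) :
    ∃ a b, a < b ∧ w a < w b ∧ (∀ c, a < c → c < b → ¬ (w a < w c ∧ w c < w b)) ∧
      RkLE (w * swap a b) u := by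
  obtain ⟨a, heq, hlt⟩ := h.exists_first_lt hne
  have hright : a < w.symm (u a) := by
    by_contra! hle
    rcases hle.eq_or_lt with ha | ha
    · rw [← ha, apply_symm_apply] at hlt
      exact hlt.ne (by rw [ha])
    · have := heq _ ha
      rw [apply_symm_apply] at this
      exact ha.ne (u.injective this).symm
  obtain ⟨b, hab, hwab, hbu, hbetween⟩ := exists_cover_toward hlt hright
  refine ⟨a, b, hab, hwab, fun c hac hcb hc => hbetween c hac hcb ⟨hc.1, hc.2.le.trans hbu⟩,
    fun p q => ?_⟩
  rw [rk_mul_swap hab hwab]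
  split_ifs with hpq
  · obtain ⟨hap, hpb, haq, hqb⟩ := hpq
    have hqu : q ≤ (u a).val := hqb.trans hbu
    refine rk_lt_of_window (q' := (u a).val + 1) (p' := a.val) (by omega) (h _ _) ?_
      (fun c hc => (heq c hc).symm) ⟨a, le_rfl, hap, hqu, Nat.lt_succ_self _⟩
    intro c hcp hqc hcu
    by_contra! hac
    rcases (show a ≤ c from hac).eq_or_lt with rfl | hac
    · omega
    · exact hbetween c hac (Fin.lt_def.2 (by omega)) ⟨haq.trans_le hqc, Nat.lt_succ_iff.1 hcu⟩
  · exact h p q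

theorem RkLE.bruhatLE {w u : Perm (Fin n)} (h : RkLE w u) : BruhatLE w u := by
  generalize hm : n * n - len w = m
  induction m generalizing w with
  | zero =>
    by_contra hle
    obtain ⟨a, b, hab, hwab, hcover, -⟩ :=
      h.exists_cover fun heq => hle (heq ▸ Relation.ReflTransGen.refl)
    have := len_mul_swap_of_cover hab hwab hcover
    have := len_le_mul_self (w * swap a b)
    omega
  | succ m ih =>
    rcases eq_or_ne w u with rfl | hne
    · exact Relation.ReflTransGen.refl
    obtain ⟨a, b, hab, hwab, hcover, hle⟩ := h.exists_cover hne
    have hlen := len_mul_swap_of_cover hab hwab hcover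
    exact Relation.ReflTransGen.head ⟨a, b, ⟨hab, hlen⟩, rfl⟩ (ih hle (by omega))

theorem BruhatLE.len_le {w u : Perm (Fin n)} (h : BruhatLE w u) : len w ≤ len u := by
  induction h with
  | refl => exact le_rfl
  | tail _ hcover ih =>
    obtain ⟨a, b, hab, rfl⟩ := hcover
    exact ih.trans (hab.2 ▸ Nat.le_succ _)

theorem RkLE.len_le {w u : Perm (Fin n)} (h : RkLE w u) : len w ≤ len u := h.bruhatLE.len_le

theorem RkLE.len_lt {w u : Perm (Fin n)} (h : RkLE w u) (hne : w ≠ u) : len w < len u := by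
  obtain ⟨a, b, hab, hw, hcover, hle⟩ := h.exists_cover hne
  have := len_mul_swap_of_cover hab hw hcover
  have := hle.len_le
  omega

theorem len_lt_len_mul_swap {w : Perm (Fin n)} {a b : Fin n} (hab : a < b) (hw : w a < w b) :
    len w < len (w * swap a b) :=
  (rkLE_mul_swap hab hw).len_lt fun h => hab.ne (swap_eq_one_iff.1 (left_eq_mul.1 h))

theorem IsBruhatTransposition.apply_lt {w : Perm (Fin n)} {a b : Fin n}
    (h : IsBruhatTransposition w a b) : w a < w b := by
  obtain ⟨hab, hlen⟩ := h
  by_contra! hle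
  have hlt := len_lt_len_mul_swap (w := w * swap a b) hab
    (by simpa using hle.lt_of_ne fun h => hab.ne' (w.injective h))
  rw [mul_swap_mul_self] at hlt
  omega

theorem isBruhatTransposition_iff {w : Perm (Fin n)} {a b : Fin n} :
    IsBruhatTransposition w a b ↔
      a < b ∧ w a < w b ∧ ∀ c, a < c → c < b → ¬ (w a < w c ∧ w c < w b) := by
  refine ⟨fun h => ⟨h.1, h.apply_lt, fun c hac hcb hwc => ?_⟩,
    fun ⟨hab, hw, hcover⟩ => ⟨hab, len_mul_swap_of_cover hab hw hcover⟩⟩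
  -- `swap a b` is a product of three transpositions, each of which raises the length.
  have hac' := len_lt_len_mul_swap hac hwc.1
  have hcb' := len_lt_len_mul_swap (w := w * swap a c) hcb
    (by simpa [swap_apply_of_ne_of_ne h.1.ne' hcb.ne'] using h.apply_lt)
  have hac'' := len_lt_len_mul_swap (w := w * swap a c * swap c b) hac
    (by simpa [swap_apply_of_ne_of_ne h.1.ne' hcb.ne', swap_apply_of_ne_of_ne hac.ne h.1.ne]
      using hwc.2)
  have hconj : w * swap a c * swap c b * swap a c = w * swap a b := by
    rw [mul_assoc, mul_assoc, ← mul_assoc (swap a c), swap_comm a c, swap_comm c b,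
      swap_mul_swap_mul_swap hcb.ne' h.1.ne', swap_comm]
  rw [hconj] at hac''
  have := h.2
  omega

theorem bruhatLE_iff {w u : Perm (Fin n)} : BruhatLE w u ↔ RkLE w u := by
  refine ⟨fun h => ?_, RkLE.bruhatLE⟩
  induction h with
  | refl => exact RkLE.refl w
  | tail _ hcover ih =>
    obtain ⟨a, b, hab, rfl⟩ := hcover
    exact ih.trans (rkLE_mul_swap hab.1 hab.apply_lt)

/-! ### The Pieri set -/

/-- The entries `t` that position `c` may hold in a permutation of the Pieri set of `σ`. In the
first `k` positions the entry `σ c` may grow, but not past a larger entry of `σ` standing between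
`c` and position `k`; in the other positions it may shrink, but not past a smaller entry standing
between position `k` and `c`. -/
def Allowed (k : ℕ) (σ : Perm (Fin n)) (c t : Fin n) : Prop :=
  (c.val < k → σ c ≤ t ∧ ∀ p : Fin n, c < p → p.val < k → σ c < σ p → t < σ p) ∧
  (k ≤ c.val → t ≤ σ c ∧ ∀ p : Fin n, k ≤ p.val → p < c → σ p < σ c → σ p < t)

/-- `μ` belongs to the Pieri set of `σ`, which `mem_bruhatInterval_eta` identifies with the
Bruhat interval `[σ, η(σ,k)]`. -/
def IsPieri (k : ℕ) (σ μ : Perm (Fin n)) : Prop := ∀ c, Allowed k σ c (μ c)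

section Allowed

variable {k : ℕ} {σ μ : Perm (Fin n)} {a b c s t : Fin n}

theorem allowed_iff_of_lt (hc : c.val < k) : Allowed k σ c t ↔
    σ c ≤ t ∧ ∀ p : Fin n, c < p → p.val < k → σ c < σ p → t < σ p := by
  simp [Allowed, hc, hc.not_ge]

theorem allowed_iff_of_ge (hc : k ≤ c.val) : Allowed k σ c t ↔
    t ≤ σ c ∧ ∀ p : Fin n, k ≤ p.val → p < c → σ p < σ c → σ p < t := by
  simp [Allowed, hc, hc.not_gt]

theorem allowed_self (k : ℕ) (σ : Perm (Fin n)) (c : Fin n) : Allowed k σ c (σ c) :=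
  ⟨fun _ => ⟨le_rfl, fun _ _ _ => id⟩, fun _ => ⟨le_rfl, fun _ _ _ => id⟩⟩

theorem Allowed.of_le (h : Allowed k σ c t) (hc : c.val < k) (hcs : σ c ≤ s) (hst : s ≤ t) :
    Allowed k σ c s := by
  rw [allowed_iff_of_lt hc] at h ⊢
  exact ⟨hcs, fun p hcp hpk hσ => hst.trans_lt (h.2 p hcp hpk hσ)⟩

theorem Allowed.of_ge (h : Allowed k σ c t) (hc : k ≤ c.val) (hts : t ≤ s) (hsc : s ≤ σ c) :
    Allowed k σ c s := by
  rw [allowed_iff_of_ge hc] at h ⊢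
  exact ⟨hsc, fun p hkp hpc hσ => (h.2 p hkp hpc hσ).trans_le hts⟩

theorem IsPieri.le_apply (h : IsPieri k σ μ) (hc : c.val < k) : σ c ≤ μ c := ((h c).1 hc).1

theorem IsPieri.apply_le (h : IsPieri k σ μ) (hc : k ≤ c.val) : μ c ≤ σ c := ((h c).2 hc).1

theorem IsPieri.apply_lt (h : IsPieri k σ μ) (hca : c < a) (ha : a.val < k) (hσ : σ c < σ a) :
    μ c < σ a :=
  ((h c).1 (Nat.lt_trans hca ha)).2 a hca ha hσ

theorem IsPieri.lt_apply (h : IsPieri k σ μ) (ha : k ≤ a.val) (hac : a < c) (hσ : σ a < σ c) :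
    σ a < μ c :=
  ((h c).2 (ha.trans hac.le)).2 a ha hac hσ

theorem IsPieri.mul_swap (h : IsPieri k σ μ) (ha : Allowed k σ a (μ b))
    (hb : Allowed k σ b (μ a)) : IsPieri k σ (μ * swap a b) := by
  intro c
  rw [Perm.mul_apply, swap_apply_def]
  split_ifs with hca hcb
  · rwa [hca]
  · rwa [hcb]
  · exact h c

theorem isPieri_self (k : ℕ) (σ : Perm (Fin n)) : IsPieri k σ σ := allowed_self k σ

theorem isKBruhatTransposition_iff : IsKBruhatTransposition k σ (a, b) ↔
    a.val < k ∧ k ≤ b.val ∧ Allowed k σ a (σ b) ∧ Allowed k σ b (σ a) := by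
  simp only [IsKBruhatTransposition, isBruhatTransposition_iff]
  refine and_congr_right fun hak => and_congr_right fun hkb => ?_
  have hab : a < b := hak.trans_le hkb
  rw [allowed_iff_of_lt hak, allowed_iff_of_ge hkb]
  constructor
  · rintro ⟨-, hσ, hcover⟩
    refine ⟨⟨hσ.le, fun c hac hck hσc => ?_⟩, hσ.le, fun c hkc hcb hσc => ?_⟩
    · have hcb : c < b := hck.trans_le hkb
      exact (not_lt.1 fun h => hcover c hac hcb ⟨hσc, h⟩).lt_of_ne (σ.injective.ne hcb.ne')
    · have hac : a < c := hak.trans_le hkc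
      exact (not_lt.1 fun h => hcover c hac hcb ⟨h, hσc⟩).lt_of_ne (σ.injective.ne hac.ne')
  · rintro ⟨⟨hσ, hleft⟩, -, hright⟩
    refine ⟨hab, hσ.lt_of_ne (σ.injective.ne hab.ne), fun c hac hcb hσc => ?_⟩
    rcases lt_or_ge c.val k with hck | hkc
    · exact lt_asymm hσc.2 (hleft c hac hck hσc.1)
    · exact lt_asymm hσc.1 (hright c hkc hcb hσc.2)

end Allowed

theorem rk_eq_add_card_of_le_apply {σ μ : Perm (Fin n)} {p : ℕ}
    (h : ∀ c : Fin n, c.val < p → σ c ≤ μ c) (q : ℕ) :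
    rk μ p q = rk σ p q + #{c : Fin n | c.val < p ∧ (σ c).val < q ∧ q ≤ (μ c).val} := by
  refine card_filter_eq_add (fun c => ?_) fun c => by omega
  have := h c
  omega

theorem rk_eq_add_card_of_apply_le {σ μ : Perm (Fin n)} {p : ℕ}
    (h : ∀ c : Fin n, p ≤ c.val → μ c ≤ σ c) (q : ℕ) :
    rk μ p q = rk σ p q + #{c : Fin n | p ≤ c.val ∧ (μ c).val < q ∧ q ≤ (σ c).val} := by
  have htotal : rk μ (p + n) q = rk σ (p + n) q := rk_of_le μ σ (by omega) q
  rw [rk_eq_rk_add_card_segment μ (p := p) (by omega),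
    rk_eq_rk_add_card_segment σ (p := p) (by omega)] at htotal
  have hsplit : #{c : Fin n | p ≤ c.val ∧ c.val < p + n ∧ q ≤ (σ c).val} =
      #{c : Fin n | p ≤ c.val ∧ c.val < p + n ∧ q ≤ (μ c).val} +
      #{c : Fin n | p ≤ c.val ∧ (μ c).val < q ∧ q ≤ (σ c).val} := by
    refine card_filter_eq_add (fun c => ?_) fun c => by omega
    have := h c
    omega
  omega

namespace IsPieri

variable {k : ℕ} {σ μ : Perm (Fin n)}

theorem rk_eq_of_le (h : IsPieri k σ μ) {p : ℕ} (hp : p ≤ k) (q : ℕ) :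
    rk μ p q = rk σ p q + #{c : Fin n | c.val < p ∧ (σ c).val < q ∧ q ≤ (μ c).val} :=
  rk_eq_add_card_of_le_apply (fun _ hc => h.le_apply (hc.trans_le hp)) q

theorem rk_eq_of_ge (h : IsPieri k σ μ) {p : ℕ} (hp : k ≤ p) (q : ℕ) :
    rk μ p q = rk σ p q + #{c : Fin n | p ≤ c.val ∧ (μ c).val < q ∧ q ≤ (σ c).val} :=
  rk_eq_add_card_of_apply_le (fun _ hc => h.apply_le (hp.trans hc)) q

theorem rkLE (h : IsPieri k σ μ) : RkLE σ μ := fun p q => by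
  rcases le_total p k with hp | hp
  · exact (h.rk_eq_of_le hp q).symm ▸ Nat.le_add_right _ _
  · exact (h.rk_eq_of_ge hp q).symm ▸ Nat.le_add_right _ _

theorem exists_upward_iff_exists_downward (h : IsPieri k σ μ) (q : ℕ) :
    (∃ c : Fin n, c.val < k ∧ (σ c).val < q ∧ q ≤ (μ c).val) ↔
      ∃ c : Fin n, k ≤ c.val ∧ (μ c).val < q ∧ q ≤ (σ c).val := by
  have hcard : #{c : Fin n | c.val < k ∧ (σ c).val < q ∧ q ≤ (μ c).val} =
      #{c : Fin n | k ≤ c.val ∧ (μ c).val < q ∧ q ≤ (σ c).val} := by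
    have := h.rk_eq_of_le le_rfl q
    have := h.rk_eq_of_ge le_rfl q
    omega
  simpa [Finset.Nonempty] using (congrArg (0 < ·) hcard)

end IsPieri

/-- `μ` is in the Pieri set of `σ` and keeps the entries below `v` of the first `k` positions of
`σ` in place. Lowering `v` step by step, one builds the greatest element of the Pieri set. -/
structure IsPieriAbove (k v : ℕ) (σ μ : Perm (Fin n)) : Prop where
  isPieri : IsPieri k σ μ
  apply_eq : ∀ {c : Fin n}, c.val < k → (σ c).val < v → μ c = σ c

/-- `w` is the greatest permutation `μ` with `IsPieriAbove k v σ μ`. -/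
structure IsGreatestPieriAbove (k v : ℕ) (σ w : Perm (Fin n)) : Prop where
  isPieriAbove : IsPieriAbove k v σ w
  rkLE : ∀ {μ}, IsPieriAbove k v σ μ → RkLE μ w

/-- The point `(p, q)` lies in the region where exchanging the entry `σ a` with the entry of `w` in
position `b` raises the rank function, `(a, b)` being a `k`-Bruhat transposition of `σ`. -/
structure InBox (k : ℕ) (σ w : Perm (Fin n)) (a b : Fin n) (p q : ℕ) : Prop where
  isKBruhat : IsKBruhatTransposition k σ (a, b)
  left_lt : a.val < p
  le_right : p ≤ b.val
  bot_lt : (σ a).val < q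
  le_top : q ≤ (w b).val

section PieriAbove

variable {k v : ℕ} {σ μ w : Perm (Fin n)} {a b c : Fin n} {p q : ℕ}

theorem isPieriAbove_zero : IsPieriAbove k 0 σ μ ↔ IsPieri k σ μ :=
  ⟨IsPieriAbove.isPieri, fun h => ⟨h, fun _ hv => absurd hv (Nat.not_lt_zero _)⟩⟩

theorem isPieriAbove_self (k v : ℕ) (σ : Perm (Fin n)) : IsPieriAbove k v σ σ :=
  ⟨isPieri_self k σ, fun _ _ => rfl⟩

theorem IsPieriAbove.mono {v' : ℕ} (hv : v ≤ v') (h : IsPieriAbove k v' σ μ) :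
    IsPieriAbove k v σ μ :=
  ⟨h.isPieri, fun hc hcv => h.apply_eq hc (hcv.trans_le hv)⟩

theorem IsPieriAbove.succ (h : IsPieriAbove k (σ a).val σ μ) (ha : a.val < k → μ a = σ a) :
    IsPieriAbove k ((σ a).val + 1) σ μ := by
  refine ⟨h.isPieri, fun {c} hc hca => ?_⟩
  rcases (Nat.lt_succ_iff.1 hca).eq_or_lt with heq | hlt
  · obtain rfl : c = a := σ.injective (Fin.ext heq)
    exact ha hc
  · exact h.apply_eq hc hlt

theorem IsPieriAbove.le_apply (h : IsPieriAbove k v σ μ) (hc : k ≤ c.val) (hv : v ≤ (σ c).val) :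
    v ≤ (μ c).val := by
  by_contra! hlt
  obtain ⟨d, hdk, hσd, hμd⟩ :=
    (h.isPieri.exists_upward_iff_exists_downward v).2 ⟨c, hc, hlt, hv⟩
  rw [h.apply_eq hdk hσd] at hμd
  omega

theorem IsPieriAbove.mul_swap (h : IsPieriAbove k v σ μ) (ha : Allowed k σ a (μ b))
    (hb : Allowed k σ b (μ a)) (hva : a.val < k → (σ a).val < v → μ b = σ a) (hkb : k ≤ b.val) :
    IsPieriAbove k v σ (μ * swap a b) := by
  refine ⟨h.isPieri.mul_swap ha hb, fun {c} hc hcv => ?_⟩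
  have hcb : c ≠ b := fun h => by omega
  rcases eq_or_ne c a with rfl | hca
  · rw [Perm.mul_apply, swap_apply_left]
    exact hva hc hcv
  · rw [Perm.mul_apply, swap_apply_of_ne_of_ne hca hcb]
    exact h.apply_eq hc hcv

-- An obstacle `σ e` between `μ c` and `σ c` is crossed upwards by an entry to its right, whose
-- value is a lower obstacle.
theorem IsPieriAbove.allowed_of_allowed_apply (h : IsPieriAbove k ((σ a).val + 1) σ μ)
    (hak : a.val < k) (hkc : k ≤ c.val) (ha : Allowed k σ a (μ c)) : Allowed k σ a (σ c) := by
  rw [allowed_iff_of_lt hak] at ha ⊢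
  refine ⟨ha.1.trans (h.isPieri.apply_le hkc), fun e hae hek hσ => ?_⟩
  generalize hm : σ e = m
  induction m using WellFoundedLT.induction generalizing e with
  | _ m ih =>
    subst hm
    by_contra! hec
    obtain ⟨d, hdk, hσd, hμd⟩ := (h.isPieri.exists_upward_iff_exists_downward (σ e).val).2
      ⟨c, hkc, ha.2 e hae hek hσ, hec⟩
    have had : σ a < σ d := by
      by_contra! hle
      rw [h.apply_eq hdk (Nat.lt_succ_of_le hle)] at hμd
      omega
    have hed : e < d := by
      by_contra! hle
      rcases hle.eq_or_lt with rfl | hlt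
      · omega
      · exact (h.isPieri.apply_lt hlt hek hσd).not_ge hμd
    exact (ih (σ d) hσd d (hae.trans hed) hdk had rfl).not_ge (hec.trans' hσd.le)

end PieriAbove

/-! ### The greatest element of the Pieri set -/

section ExistsSucc

variable {k : ℕ} {σ μ : Perm (Fin n)} {a b c : Fin n}

theorem IsPieriAbove.le_of_apply_eq (h : IsPieriAbove k (σ a).val σ μ) (hb : μ b = σ a)
    (hba : b ≠ a) : k ≤ b.val := by
  by_contra! hbk
  have hlt : σ b < σ a := (hb ▸ h.isPieri.le_apply hbk).lt_of_ne (σ.injective.ne hba)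
  exact hlt.ne ((h.apply_eq hbk hlt).symm.trans hb)

theorem IsPieriAbove.apply_gt_of_ne (h : IsPieriAbove k (σ a).val σ μ) (hb : μ b = σ a)
    (hck : k ≤ c.val) (hσ : σ a < σ c) (hcb : c ≠ b) : σ a < μ c :=
  lt_of_le_of_ne (h.le_apply hck (Fin.le_def.1 hσ.le)) fun heq => hcb (μ.injective (heq ▸ hb.symm))

theorem IsPieriAbove.exists_lower (h : IsPieriAbove k (σ a).val σ μ) (hak : a.val < k)
    (hb : μ b = σ a) (hkb : k ≤ b.val) (hσ : σ a < σ b) (hlt : σ b < μ a) :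
    ∃ c, k ≤ c.val ∧ c < b ∧ σ a < μ c ∧ μ c ≤ σ b ∧ σ b < σ c := by
  obtain ⟨c, hkc, hμc, hσc⟩ :=
    (h.isPieri.exists_upward_iff_exists_downward ((σ b).val + 1)).1 ⟨a, hak, by omega, by omega⟩
  have hbc : σ b < σ c := hσc
  have hcb : c < b := by
    by_contra! hle
    rcases hle.eq_or_lt with rfl | hlt
    · exact hbc.false
    · have := h.isPieri.lt_apply hkb hlt hbc
      omega
  exact ⟨c, hkc, hcb, h.apply_gt_of_ne hb hkc (hσ.trans hbc) hcb.ne, Nat.lt_succ_iff.1 hμc, hbc⟩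

theorem IsPieriAbove.exists_succ_of_le (h : IsPieriAbove k (σ a).val σ μ) (hak : a.val < k)
    (hb : μ b = σ a) (hkb : k ≤ b.val) (hμa : σ a < μ a) (hle : μ a ≤ σ b) :
    ∃ μ', IsPieriAbove k ((σ a).val + 1) σ μ' ∧ (∀ d, b < d → μ' d = μ d) ∧
      ∀ p q, rk μ p q ≤ rk μ' p q ∨
        rk μ p q ≤ rk μ' p q + 1 ∧ ∃ d ≤ b, InBox k σ μ' a d p q := by
  have hab : a < b := hak.trans_le hkb
  have hallow : Allowed k σ b (σ a) := hb ▸ h.isPieri b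
  have hfix : IsPieriAbove k ((σ a).val + 1) σ (μ * swap a b) :=
    (h.mul_swap (hb ▸ allowed_self k σ a) (hallow.of_ge hkb hμa.le hle) (fun _ _ => hb) hkb).succ
      fun _ => by simpa using hb
  refine ⟨_, hfix, fun d hd => ?_, fun p q => ?_⟩
  · rw [Perm.mul_apply, swap_apply_of_ne_of_ne (hab.trans hd).ne' hd.ne']
  rw [rk_eq_rk_mul_swap_add hab (hb ▸ hμa), hb]
  split_ifs with hbox
  · refine Or.inr ⟨le_rfl, b, le_rfl, isKBruhatTransposition_iff.2 ⟨hak, hkb, ?_, hallow⟩,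
      hbox.1, hbox.2.1, hbox.2.2.1, by simpa using hbox.2.2.2⟩
    exact hfix.allowed_of_allowed_apply hak hkb (by simpa using h.isPieri a)
  · exact Or.inl le_rfl

-- The entry `σ a` is brought back to position `a` from the position `b` where `μ` has put it:
-- directly, or through an intermediate position `c < b` when `μ a` is too large for position `b`.
theorem IsPieriAbove.exists_succ (hak : a.val < k) (h : IsPieriAbove k (σ a).val σ μ)
    (hb : μ b = σ a) :
    ∃ μ', IsPieriAbove k ((σ a).val + 1) σ μ' ∧ (∀ d, b < d → μ' d = μ d) ∧
      ∀ p q, rk μ p q ≤ rk μ' p q ∨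
        rk μ p q ≤ rk μ' p q + 1 ∧ ∃ d ≤ b, InBox k σ μ' a d p q := by
  induction b using WellFoundedLT.induction generalizing μ with
  | _ b ih =>
  rcases eq_or_ne b a with rfl | hba
  · exact ⟨μ, h.succ fun _ => hb, fun _ _ => rfl, fun p q => Or.inl le_rfl⟩
  have hkb := h.le_of_apply_eq hb hba
  have hab : a < b := hak.trans_le hkb
  have hallow : Allowed k σ b (σ a) := hb ▸ h.isPieri b
  have hσ : σ a < σ b := (hb ▸ h.isPieri.apply_le hkb).lt_of_ne (σ.injective.ne hab.ne)
  have hμa : σ a < μ a := (h.isPieri.le_apply hak).lt_of_ne fun heq =>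
    hba (μ.injective (hb.trans heq))
  rcases le_or_gt (μ a) (σ b) with hle | hlt
  · exact h.exists_succ_of_le hak hb hkb hμa hle
  · obtain ⟨c, hkc, hcb, hac, hμc, hσc⟩ := h.exists_lower hak hb hkb hσ hlt
    have hallowc : Allowed k σ c (σ a) := (allowed_iff_of_ge hkc).2 ⟨(hσ.trans hσc).le,
      fun e hke hec hσe => ((allowed_iff_of_ge hkb).1 hallow).2 e hke (hec.trans hcb)
        ((h.isPieri.lt_apply hke hec hσe).trans_le hμc)⟩
    have hmove : IsPieriAbove k (σ a).val σ (μ * swap c b) :=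
      h.mul_swap (hb ▸ hallowc) (hallow.of_ge hkb hac.le hμc) (fun hck => by omega) hkb
    obtain ⟨μ', hfix, hagree, hrk⟩ := ih c hcb hmove (by simpa using hb)
    refine ⟨μ', hfix, fun d hd => ?_, fun p q => ?_⟩
    · rw [hagree d (hcb.trans hd), Perm.mul_apply,
        swap_apply_of_ne_of_ne (hcb.trans hd).ne' hd.ne']
    rw [rk_eq_rk_mul_swap_add hcb (hb ▸ hac), hb]
    split_ifs with hbox
    · obtain ⟨hcp, hpb, haq, hqc⟩ := hbox
      have hle : rk (μ * swap c b) p q ≤ rk μ' p q := (hrk p q).resolve_right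
        fun ⟨_, d, hdc, hd⟩ => by have := hd.le_right; omega
      refine Or.inr ⟨by omega, b, le_rfl, isKBruhatTransposition_iff.2 ⟨hak, hkb, ?_, hallow⟩,
        by omega, hpb, haq, by simpa [hagree b hcb] using hqc⟩
      exact (h.isPieri a).of_le hak hσ.le hlt.le
    · exact (hrk p q).imp_right fun ⟨hle, d, hdc, hd⟩ => ⟨hle, d, hdc.trans hcb.le, hd⟩

end ExistsSucc

section Dominate

variable {k : ℕ} {σ μ w : Perm (Fin n)} {a b c : Fin n} {p q : ℕ}

theorem IsPieriAbove.isKBruhatTransposition_of_inBox (hμ : IsPieriAbove k ((σ a).val + 1) σ μ)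
    (hb : InBox k σ μ a b p q) (hkc : k ≤ c.val) (hcb : c < b) (hμc : (μ c).val < q)
    (hσc : q ≤ (σ c).val) : IsKBruhatTransposition k σ (a, c) := by
  obtain ⟨hak, hkb, hallow, hallow'⟩ := isKBruhatTransposition_iff.1 hb.isKBruhat
  have hμb := hμ.isPieri.apply_le hkb
  have hbot := hb.bot_lt
  have htop := hb.le_top
  have hac : σ a ≤ μ c := Nat.le_of_succ_le (hμ.le_apply hkc (by omega))
  refine isKBruhatTransposition_iff.2 ⟨hak, hkc, ?_, (allowed_iff_of_ge hkc).2 ⟨by omega, ?_⟩⟩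
  · exact hμ.allowed_of_allowed_apply hak hkc (hallow.of_le hak hac (by omega))
  · intro e hke hec hσe
    have := hμ.isPieri.lt_apply hke hec hσe
    exact ((allowed_iff_of_ge hkb).1 hallow').2 e hke (hec.trans hcb) (by omega)

theorem IsPieriAbove.rk_eq_add_card_of_inBox (hw : IsPieriAbove k ((σ a).val + 1) σ w)
    (hb : IsKBruhatTransposition k σ (a, b)) (hap : a.val < p) (hpk : p ≤ k)
    (hqb : q ≤ (σ b).val) :
    rk w k q = rk w p q + #{c : Fin n | p ≤ c.val ∧ c.val < k ∧ q ≤ (σ c).val} := by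
  obtain ⟨hak, -, hallow, -⟩ := isKBruhatTransposition_iff.1 hb
  rw [rk_eq_rk_add_card_segment w hpk]
  refine congrArg (rk w p q + #·) (filter_congr fun c _ =>
    and_congr_right fun hpc => and_congr_right fun hck => ?_)
  refine ⟨fun hqc => ?_, fun hqc => hqc.trans (hw.isPieri.le_apply hck)⟩
  rcases le_or_gt (σ c) (σ a) with hle | hgt
  · rwa [hw.apply_eq hck (Nat.lt_succ_of_le hle)] at hqc
  · exact hqb.trans (((allowed_iff_of_lt hak).1 hallow).2 c (hap.trans_le hpc) hck hgt).le

theorem IsPieriAbove.rk_lt_of_inBox_of_ge (hμ : IsPieriAbove k ((σ a).val + 1) σ μ)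
    (hw : IsPieriAbove k ((σ a).val + 1) σ w) (hle : RkLE μ w) (hkp : k ≤ p)
    (hb : InBox k σ μ a b p q) (hbox : ∀ c, ¬ InBox k σ w a c p q) : rk μ p q < rk w p q := by
  have hpb := hb.le_right
  have hsegment : #{c : Fin n | p ≤ c.val ∧ c.val < b.val + 1 ∧ q ≤ (w c).val} <
      #{c : Fin n | p ≤ c.val ∧ c.val < b.val + 1 ∧ q ≤ (μ c).val} := by
    refine card_lt_card ((ssubset_iff_of_subset fun c hc => ?_).2 ⟨b, ?_, ?_⟩)
    · obtain ⟨-, hpc, hcb, hqc⟩ := mem_filter.1 hc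
      refine mem_filter.2 ⟨mem_univ c, hpc, hcb, ?_⟩
      by_contra! hμc
      have hcb' : c < b := by
        refine lt_of_le_of_ne (Nat.lt_succ_iff.1 hcb) fun heq => ?_
        have := heq ▸ hb.le_top
        omega
      refine hbox c ⟨hμ.isKBruhatTransposition_of_inBox hb (hkp.trans hpc) hcb' hμc ?_,
        hb.left_lt, hpc, hb.bot_lt, hqc⟩
      exact hqc.trans (hw.isPieri.apply_le (hkp.trans hpc))
    · exact mem_filter.2 ⟨mem_univ b, hpb, Nat.lt_succ_self _, hb.le_top⟩
    · exact fun hwb => hbox b ⟨hb.isKBruhat, hb.left_lt, hpb, hb.bot_lt, (mem_filter.1 hwb).2.2.2⟩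
  have hend := hle (b.val + 1) q
  rw [rk_eq_rk_add_card_segment μ (p := p) (by omega),
    rk_eq_rk_add_card_segment w (p := p) (by omega)] at hend
  omega

theorem IsPieriAbove.rk_lt_of_inBox (hμ : IsPieriAbove k ((σ a).val + 1) σ μ)
    (hw : IsPieriAbove k ((σ a).val + 1) σ w) (hle : RkLE μ w)
    (hb : InBox k σ μ a b p q) (hbox : ∀ c, ¬ InBox k σ w a c p q) : rk μ p q < rk w p q := by
  rcases le_total p k with hpk | hkp
  · obtain ⟨hak, hkb, -, -⟩ := isKBruhatTransposition_iff.1 hb.isKBruhat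
    have hqb : q ≤ (σ b).val := hb.le_top.trans (hμ.isPieri.apply_le hkb)
    have hlt := hμ.rk_lt_of_inBox_of_ge hw hle le_rfl
      (b := b) ⟨hb.isKBruhat, hak, hkb, hb.bot_lt, hb.le_top⟩ fun c hc =>
        hbox c ⟨hc.isKBruhat, hb.left_lt, hpk.trans hc.le_right, hc.bot_lt, hc.le_top⟩
    have := hμ.rk_eq_add_card_of_inBox hb.isKBruhat hb.left_lt hpk hqb
    have := hw.rk_eq_add_card_of_inBox hb.isKBruhat hb.left_lt hpk hqb
    omega
  · exact hμ.rk_lt_of_inBox_of_ge hw hle hkp hb hbox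

end Dominate

section MaxStep

variable {k v : ℕ} {σ μ w : Perm (Fin n)} {a b c : Fin n}

theorem mul_swap_apply_of_lt (w : Perm (Fin n)) (hac : a < c) (hcb : c < b) :
    (w * swap a b) c = w c := by
  rw [Perm.mul_apply, swap_apply_of_ne_of_ne hac.ne' hcb.ne]

theorem rk_mul_prod_swap {l : List (Fin n)} (hal : ∀ b ∈ l, a < b ∧ w a < w b)
    (hl : l.Pairwise fun b c => c < b ∧ w b < w c) (p q : ℕ) :
    rk (w * (l.map (swap a)).prod) p q = rk w p q +
      if ∃ b ∈ l, a.val < p ∧ p ≤ b.val ∧ (w a).val < q ∧ q ≤ (w b).val then 1 else 0 := by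
  induction l generalizing w with
  | nil => simp
  | cons b l ih =>
    obtain ⟨hab, hwab⟩ := hal b List.mem_cons_self
    rw [List.forall_mem_cons] at hal
    rw [List.pairwise_cons] at hl
    have hkeep : ∀ c ∈ l, (w * swap a b) c = w c := fun c hc =>
      mul_swap_apply_of_lt w (hal.2 c hc).1 (hl.1 c hc).1
    have ha : (w * swap a b) a = w b := by simp
    rw [List.map_cons, List.prod_cons, ← mul_assoc, ih, rk_mul_swap hab hwab, ha, add_assoc]
    · congr 1
      have hsteps : ∀ c ∈ l, c < b ∧ w b < w c := hl.1
      have hrest : (∃ c ∈ l, a.val < p ∧ p ≤ c.val ∧ (w b).val < q ∧ q ≤ ((w * swap a b) c).val) ↔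
          ∃ c ∈ l, a.val < p ∧ p ≤ c.val ∧ (w b).val < q ∧ q ≤ (w c).val :=
        exists_congr fun c => and_congr_right fun hc => by rw [hkeep c hc]
      simp only [hrest, List.exists_mem_cons_iff]
      by_cases hb : a.val < p ∧ p ≤ b.val ∧ (w a).val < q ∧ q ≤ (w b).val
      · have hnot : ¬ ∃ c ∈ l, a.val < p ∧ p ≤ c.val ∧ (w b).val < q ∧ q ≤ (w c).val := by
          rintro ⟨c, -, hc⟩
          omega
        rw [if_pos hb, if_neg hnot, if_pos (Or.inl hb)]
      · rw [if_neg hb, zero_add]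
        refine if_congr ?_ rfl rfl
        rw [or_iff_right hb]
        refine exists_congr fun c => and_congr_right fun hc => ?_
        have := hsteps c hc
        omega
    · exact fun c hc => ⟨(hal.2 c hc).1, by rw [ha, hkeep c hc]; exact (hl.1 c hc).2⟩
    · refine hl.2.imp_of_mem fun {c d} hc hd hcd => ?_
      rwa [hkeep c hc, hkeep d hd]

theorem IsPieriAbove.mul_prod_swap {l : List (Fin n)} (hw : IsPieriAbove k (σ a).val σ w)
    (hlσ : ∀ b ∈ l, IsKBruhatTransposition k σ (a, b)) (hlw : ∀ b ∈ l, w a < w b)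
    (hl : l.Pairwise fun b c => c < b ∧ w b < w c) :
    IsPieriAbove k (σ a).val σ (w * (l.map (swap a)).prod) := by
  induction l generalizing w with
  | nil => simpa using hw
  | cons b l ih =>
    rw [List.forall_mem_cons] at hlσ hlw
    rw [List.pairwise_cons] at hl
    obtain ⟨hak, hkb, hallow, hallow'⟩ := isKBruhatTransposition_iff.1 hlσ.1
    have hwa := hw.isPieri.le_apply hak
    have hwb := hw.isPieri.apply_le hkb
    have hkeep : ∀ c ∈ l, (w * swap a b) c = w c := fun c hc =>
      mul_swap_apply_of_lt w (hlσ.2 c hc).2.2.1 (hl.1 c hc).1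
    rw [List.map_cons, List.prod_cons, ← mul_assoc]
    refine ih (hw.mul_swap (hallow.of_le hak (hwa.trans hlw.1.le) hwb)
      (hallow'.of_ge hkb hwa (hlw.1.le.trans hwb)) (fun _ h => absurd h (lt_irrefl _)) hkb)
      hlσ.2 (fun c hc => ?_) (hl.2.imp_of_mem fun {c d} hc hd hcd => ?_)
    · rw [hkeep c hc]
      simpa using (hl.1 c hc).2
    · rwa [hkeep c hc, hkeep d hd]

theorem IsKBruhatTransposition.lt_of_apply_lt (hb : IsKBruhatTransposition k σ (a, b))
    (hc : IsKBruhatTransposition k σ (a, c)) (hbc : σ b < σ c) : c < b := by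
  obtain ⟨-, hkb, hallow, -⟩ := isKBruhatTransposition_iff.1 hb
  obtain ⟨hak, hkc, -, hallow'⟩ := isKBruhatTransposition_iff.1 hc
  by_contra! hle
  rcases hle.eq_or_lt with rfl | hlt
  · exact hbc.false
  · exact ((((allowed_iff_of_ge hkc).1 hallow').2 b hkb hlt hbc).trans_le
      ((allowed_iff_of_lt hak).1 hallow).1).false

theorem IsPieriAbove.lt_apply (hw : IsPieriAbove k ((σ a).val + 1) σ w)
    (hb : IsKBruhatTransposition k σ (a, b)) : σ a < w b :=
  hw.le_apply hb.2.1 hb.2.2.apply_lt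

-- Otherwise exchanging the entries of `w` in positions `c` and `b` would give a larger element.
theorem IsGreatestPieriAbove.apply_lt_apply (hw : IsGreatestPieriAbove k ((σ a).val + 1) σ w)
    (hb : IsKBruhatTransposition k σ (a, b)) (hc : IsKBruhatTransposition k σ (a, c))
    (hbc : σ b < σ c) : w b < w c := by
  have hcb := hb.lt_of_apply_lt hc hbc
  obtain ⟨-, hkb, -, hallow⟩ := isKBruhatTransposition_iff.1 hb
  have hkc : k ≤ c.val := hc.2.1
  by_contra! hle
  have hlt : w c < w b := hle.lt_of_ne (w.injective.ne hcb.ne)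
  have hwb := hw.isPieriAbove.isPieri.apply_le hkb
  have hswap : IsPieriAbove k ((σ a).val + 1) σ (w * swap c b) :=
    hw.isPieriAbove.mul_swap
      ((hw.isPieriAbove.isPieri c).of_ge hkc hle (hwb.trans hbc.le))
      (hallow.of_ge hkb (hw.isPieriAbove.lt_apply hc).le (hle.trans hwb))
      (fun hck => absurd hck hkc.not_gt) hkb
  have hrk := hw.rkLE hswap b.val (w b).val
  rw [rk_mul_swap hcb hlt, if_pos ⟨hcb, le_rfl, hlt, le_rfl⟩] at hrk
  omega

theorem IsGreatestPieriAbove.mul_prod_swap {l : List (Fin n)}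
    (hw : IsGreatestPieriAbove k ((σ a).val + 1) σ w) (hak : a.val < k)
    (hmem : ∀ b, b ∈ l ↔ IsKBruhatTransposition k σ (a, b))
    (hsorted : l.Pairwise fun b c => σ b < σ c) :
    IsGreatestPieriAbove k (σ a).val σ (w * (l.map (swap a)).prod) := by
  have hwa : w a = σ a := hw.isPieriAbove.apply_eq hak (Nat.lt_succ_self _)
  have hal : ∀ b ∈ l, a < b ∧ w a < w b := fun b hb =>
    ⟨((hmem b).1 hb).2.2.1, hwa ▸ hw.isPieriAbove.lt_apply ((hmem b).1 hb)⟩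
  have hpair : l.Pairwise fun b c => c < b ∧ w b < w c := hsorted.imp_of_mem fun hb hc hbc =>
    ⟨((hmem _).1 hb).lt_of_apply_lt ((hmem _).1 hc) hbc,
      hw.apply_lt_apply ((hmem _).1 hb) ((hmem _).1 hc) hbc⟩
  refine ⟨(hw.isPieriAbove.mono (Nat.le_succ _)).mul_prod_swap (fun b => (hmem b).1)
    (fun b hb => (hal b hb).2) hpair, fun {μ} hμ p q => ?_⟩
  obtain ⟨μ', hμ', -, hrk⟩ := hμ.exists_succ hak (μ.apply_symm_apply (σ a))
  have hle := hw.rkLE hμ'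
  have hinBox : (∃ b ∈ l, a.val < p ∧ p ≤ b.val ∧ (w a).val < q ∧ q ≤ (w b).val) ↔
      ∃ b, InBox k σ w a b p q := by
    rw [hwa]
    exact exists_congr fun b =>
      ⟨fun ⟨hb, hap, hpb, haq, hqb⟩ => ⟨(hmem b).1 hb, hap, hpb, haq, hqb⟩,
        fun ⟨hb, hap, hpb, haq, hqb⟩ => ⟨(hmem b).2 hb, hap, hpb, haq, hqb⟩⟩
  rw [rk_mul_prod_swap hal hpair]
  have hle' := hle p q
  split_ifs with hbox
  · rcases hrk p q with h | h <;> omega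
  · rcases hrk p q with h | ⟨h, b, -, hb⟩
    · omega
    · have := hμ'.rk_lt_of_inBox hw.isPieriAbove hle hb (not_exists.1 (mt hinBox.2 hbox))
      omega

end MaxStep

section Eta

variable {k : ℕ} {σ μ : Perm (Fin n)}

open Classical in
/-- The positions `b` such that `(a, b)` belongs to `W k σ`, by increasing entry. -/
noncomputable def partners (k : ℕ) (σ : Perm (Fin n)) (a : Fin n) : List (Fin n) :=
  ((List.finRange n).map σ.symm).filter fun b => decide (IsKBruhatTransposition k σ (a, b))

theorem mem_partners {a b : Fin n} :
    b ∈ partners k σ a ↔ IsKBruhatTransposition k σ (a, b) := by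
  simp only [partners, List.mem_filter, List.mem_map, List.mem_finRange, true_and,
    decide_eq_true_eq, and_iff_right_iff_imp]
  exact fun _ => ⟨σ b, σ.symm_apply_apply b⟩

theorem partners_pairwise (k : ℕ) (σ : Perm (Fin n)) (a : Fin n) :
    (partners k σ a).Pairwise fun b c => σ b < σ c := by
  refine List.Pairwise.filter _ ?_
  rw [List.pairwise_map]
  exact (List.pairwise_lt_finRange n).imp fun h => by simpa using h

theorem partners_eq_nil {a : Fin n} (hka : k ≤ a.val) : partners k σ a = [] :=
  List.eq_nil_iff_forall_not_mem.2 fun _ hb => hka.not_gt (mem_partners.1 hb).1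

/-- The product of the transpositions in `W k σ` that move the entry `v`. -/
noncomputable def entryProd (k : ℕ) (σ : Perm (Fin n)) (v : Fin n) : Perm (Fin n) :=
  ((partners k σ (σ.symm v)).map (swap (σ.symm v))).prod

theorem eta_eq (k : ℕ) (σ : Perm (Fin n)) :
    eta k σ = σ * ((List.finRange n).reverse.map (entryProd k σ)).prod := by
  rw [eta, W, allPairs, List.filter_flatMap, List.map_flatMap, List.flatMap, List.prod_flatten,
    List.map_map]
  congr 3
  funext v
  simp only [Function.comp_apply, entryProd, partners, List.filter_map, List.map_map]
  rfl

theorem IsPieriAbove.eq_self (h : IsPieriAbove k n σ μ) : μ = σ := by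
  ext c
  rcases lt_or_ge c.val k with hc | hc
  · rw [h.apply_eq hc (σ c).isLt]
  · by_contra hne
    have hlt := lt_of_le_of_ne (Fin.le_def.1 (h.isPieri.apply_le hc)) hne
    obtain ⟨d, hdk, hσd, hμd⟩ :=
      (h.isPieri.exists_upward_iff_exists_downward (σ c).val).2 ⟨c, hc, hlt, le_rfl⟩
    rw [h.apply_eq hdk (σ d).isLt] at hμd
    omega

theorem IsGreatestPieriAbove.mul_entryProd {w : Perm (Fin n)} {v : Fin n}
    (hw : IsGreatestPieriAbove k (v.val + 1) σ w) :
    IsGreatestPieriAbove k v.val σ (w * entryProd k σ v) := by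
  obtain ⟨a, rfl⟩ := σ.surjective v
  rw [entryProd, σ.symm_apply_apply]
  rcases lt_or_ge a.val k with hak | hka
  · exact hw.mul_prod_swap hak (fun b => mem_partners) (partners_pairwise k σ a)
  · rw [partners_eq_nil hka, List.map_nil, List.prod_nil, mul_one]
    exact ⟨hw.isPieriAbove.mono (Nat.le_succ _),
      fun hμ => hw.rkLE (hμ.succ fun hak => absurd hak hka.not_gt)⟩

theorem isGreatestPieriAbove_drop (k : ℕ) (σ : Perm (Fin n)) {v : ℕ} (hv : v ≤ n) :
    IsGreatestPieriAbove k v σ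
      (σ * (((List.finRange n).drop v).reverse.map (entryProd k σ)).prod) := by
  induction hv using Nat.decreasingInduction with
  | self =>
    have hdrop : (List.finRange n).drop n = [] := List.drop_eq_nil_of_le (by simp)
    rw [hdrop, List.reverse_nil, List.map_nil, List.prod_nil, mul_one]
    exact ⟨isPieriAbove_self k n σ, fun h => h.eq_self ▸ RkLE.refl σ⟩
  | of_succ v hv ih =>
    have hdrop : (List.finRange n).drop v = ⟨v, hv⟩ :: (List.finRange n).drop (v + 1) := by
      rw [List.drop_eq_getElem_cons (by simpa using hv), List.getElem_finRange]
      rfl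
    rw [hdrop, List.reverse_cons, List.map_append, List.prod_append, List.map_singleton,
      List.prod_singleton, ← mul_assoc]
    exact ih.mul_entryProd (v := ⟨v, hv⟩)

theorem isGreatestPieriAbove_eta (k : ℕ) (σ : Perm (Fin n)) :
    IsGreatestPieriAbove k 0 σ (eta k σ) :=
  eta_eq k σ ▸ isGreatestPieriAbove_drop k σ (Nat.zero_le n)

theorem IsPieri.rk_self_eq_of_lt (h : IsPieri k σ μ) {p : Fin n} (hp : p.val < k) :
    rk μ p (σ p).val = rk σ p (σ p).val := by
  rw [h.rk_eq_of_le hp.le, Nat.add_eq_left, card_eq_zero, filter_eq_empty_iff]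
  rintro c - ⟨hcp, hσ, hμ⟩
  exact (h.apply_lt hcp hp hσ).not_ge hμ

theorem IsPieri.rk_self_eq_of_ge (h : IsPieri k σ μ) {p : Fin n} (hp : k ≤ p.val) :
    rk μ (p.val + 1) ((σ p).val + 1) = rk σ (p.val + 1) ((σ p).val + 1) := by
  rw [h.rk_eq_of_ge (by omega), Nat.add_eq_left, card_eq_zero, filter_eq_empty_iff]
  rintro c - ⟨hpc, hμ, hσ⟩
  exact (h.lt_apply hp hpc hσ).not_ge (Nat.lt_succ_iff.1 hμ)

theorem RkLE.le_apply (hle : RkLE σ μ) {p : Fin n}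
    (heq : rk μ p (σ p).val = rk σ p (σ p).val) : σ p ≤ μ p := by
  have hnext := hle (p + 1) (σ p)
  rw [rk_succ, rk_succ, heq, if_pos le_rfl] at hnext
  by_contra! hlt
  rw [if_neg (Nat.not_le.2 hlt)] at hnext
  omega

theorem RkLE.apply_le (hle : RkLE σ μ) {p : Fin n}
    (heq : rk μ (p.val + 1) ((σ p).val + 1) = rk σ (p.val + 1) ((σ p).val + 1)) : μ p ≤ σ p := by
  have hprev := hle p ((σ p).val + 1)
  rw [rk_succ, rk_succ] at heq
  by_contra! hlt
  rw [if_pos (Nat.succ_le_of_lt hlt), if_neg (Nat.not_succ_le_self _)] at heq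
  omega

theorem IsPieri.of_rkLE {η : Perm (Fin n)} (hη : IsPieri k σ η) (hσμ : RkLE σ μ)
    (hμη : RkLE μ η) : IsPieri k σ μ := by
  have heq : ∀ p : Fin n, p.val < k → rk μ p (σ p).val = rk σ p (σ p).val := fun p hp =>
    le_antisymm ((hμη _ _).trans (hη.rk_self_eq_of_lt hp).le) (hσμ _ _)
  have heq' : ∀ p : Fin n, k ≤ p.val →
      rk μ (p.val + 1) ((σ p).val + 1) = rk σ (p.val + 1) ((σ p).val + 1) := fun p hp =>
    le_antisymm ((hμη _ _).trans (hη.rk_self_eq_of_ge hp).le) (hσμ _ _)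
  have hup : ∀ c : Fin n, c.val < k → σ c ≤ μ c := fun c hc => hσμ.le_apply (heq c hc)
  have hdown : ∀ c : Fin n, k ≤ c.val → μ c ≤ σ c := fun c hc => hσμ.apply_le (heq' c hc)
  refine fun c => ⟨fun hc => ⟨hup c hc, fun p hcp hpk hσ => ?_⟩,
    fun hc => ⟨hdown c hc, fun p hkp hpc hσ => ?_⟩⟩
  · have hrk := heq p hpk
    rw [rk_eq_add_card_of_le_apply fun d hd => hup d (hd.trans hpk), Nat.add_eq_left,
      card_eq_zero, filter_eq_empty_iff] at hrk
    exact not_le.1 fun hle => hrk (mem_univ c) ⟨hcp, hσ, hle⟩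
  · have hrk := heq' p hkp
    rw [rk_eq_add_card_of_apply_le fun d hd => hdown d (by omega), Nat.add_eq_left,
      card_eq_zero, filter_eq_empty_iff] at hrk
    exact not_le.1 fun hle => hrk (mem_univ c) ⟨hpc, Nat.lt_succ_of_le hle, hσ⟩

theorem mem_bruhatInterval_eta : μ ∈ bruhatInterval σ (eta k σ) ↔ IsPieri k σ μ := by
  have hη := isGreatestPieriAbove_eta k σ
  simp only [bruhatInterval, mem_filter, mem_univ, true_and, bruhatLE_iff]
  exact ⟨fun h => hη.isPieriAbove.isPieri.of_rkLE h.1 h.2,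
    fun h => ⟨h.rkLE, hη.rkLE (isPieriAbove_zero.2 h)⟩⟩

theorem bruhatLE_eta (k : ℕ) (σ : Perm (Fin n)) : BruhatLE σ (eta k σ) :=
  bruhatLE_iff.2 (isGreatestPieriAbove_eta k σ).isPieriAbove.isPieri.rkLE

end Eta

/-! ### Independence of the reduced word -/

section Simple

variable {i j : Fin (n - 1)}

theorem simple_apply_lo_of_lt (h : i.val + 1 < j.val) : simple i (lo j) = lo j :=
  simple_apply_of_ne (Fin.ne_of_val_ne (by simp; omega)) (Fin.ne_of_val_ne (by simp; omega))

theorem simple_apply_hi_of_lt (h : i < j) : simple i (hi j) = hi j :=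
  simple_apply_of_ne (Fin.ne_of_val_ne (by simp; omega)) (Fin.ne_of_val_ne (by simp; omega))

theorem simple_apply_lo_of_gt (h : i < j) : simple j (lo i) = lo i :=
  simple_apply_of_ne (Fin.ne_of_val_ne (by simp; omega)) (Fin.ne_of_val_ne (by simp; omega))

theorem simple_apply_hi_of_gt (h : i.val + 1 < j.val) : simple j (hi i) = hi i :=
  simple_apply_of_ne (Fin.ne_of_val_ne (by simp; omega)) (Fin.ne_of_val_ne (by simp; omega))

theorem hi_eq_lo (h : i.val + 1 = j.val) : hi i = lo j := Fin.ext h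

theorem simple_apply_lo_of_adjacent (h : i.val + 1 = j.val) : simple i (lo j) = lo i :=
  hi_eq_lo h ▸ simple_hi i

theorem simple_comm (h : i.val + 1 < j.val) : simple i * simple j = simple j * simple i := by
  rw [simple_eq_swap j, mul_swap_eq_swap_mul, simple_apply_lo_of_lt h,
    simple_apply_hi_of_lt (by omega)]

theorem simple_braid (h : i.val + 1 = j.val) :
    simple i * simple j * simple i = simple j * simple i * simple j := by
  have hij : lo i ≠ lo j := hi_eq_lo h ▸ lo_ne_hi i
  have hij' : lo i ≠ hi j := Fin.ne_of_val_ne (by simp; omega)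
  rw [simple_eq_swap, simple_eq_swap, hi_eq_lo h, swap_mul_swap_mul_swap hij hij',
    swap_comm (lo i) (lo j), swap_comm (lo j) (hi j),
    swap_mul_swap_mul_swap (lo_ne_hi j).symm hij'.symm, swap_comm]

end Simple

section ReducedWords

variable {w : Perm (Fin n)} {i j : Fin (n - 1)}

theorem exists_common_prefix_of_comm (hij : i.val + 1 < j.val) (hwi : w (hi i) < w (lo i))
    (hwj : w (hi j) < w (lo j)) :
    ∃ l, IsReducedWord (l ++ [j]) (w * simple i) ∧ IsReducedWord (l ++ [i]) (w * simple j) := by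
  obtain ⟨l, hl⟩ := exists_reducedWord (w * simple i * simple j)
  have hlt : i < j := by omega
  refine ⟨l, ?_, ?_⟩
  · simpa using hl.append_singleton (i := j)
      (by simpa [simple_apply_lo_of_lt hij, simple_apply_hi_of_lt hlt] using hwj)
  · have := hl.append_singleton (i := i)
      (by simpa [simple_apply_lo_of_gt hlt, simple_apply_hi_of_gt hij] using hwi)
    rwa [mul_assoc w, simple_comm hij, ← mul_assoc, mul_simple_mul_simple] at this

theorem exists_common_prefix_of_adjacent (hij : i.val + 1 = j.val) (hwi : w (hi i) < w (lo i))
    (hwj : w (hi j) < w (lo j)) :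
    ∃ l, IsReducedWord (l ++ [i] ++ [j]) (w * simple i) ∧
      IsReducedWord (l ++ [j] ++ [i]) (w * simple j) := by
  obtain ⟨l, hl⟩ := exists_reducedWord (w * simple i * simple j * simple i)
  have hlt : i < j := by omega
  have hmid := hi_eq_lo hij
  have hlow := simple_apply_lo_of_adjacent hij
  have hhi := simple_apply_hi_of_lt hlt
  have hlo := simple_apply_lo_of_gt hlt
  rw [hmid] at hwi
  refine ⟨l, ?_, ?_⟩
  · have hli := hl.append_singleton (i := i) (by simpa [hmid, hlow, hhi, hlo] using hwj)
    simpa using hli.append_singleton (i := j)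
      (by simpa [hmid, hlow, hhi, hlo] using hwj.trans hwi)
  · have hlj := hl.append_singleton (i := j) (by simpa [hmid, hlow, hhi, hlo] using hwi)
    have hlji := hlj.append_singleton (i := i)
      (by simpa [hmid, hlow, hhi, hlo] using hwj.trans hwi)
    have hprod : w * simple i * simple j * simple i * simple j * simple i = w * simple j := by
      calc w * simple i * simple j * simple i * simple j * simple i
          = w * (simple i * simple j * simple i) * simple j * simple i := by
            simp only [mul_assoc]
        _ = w * simple j * simple i * simple j * simple j * simple i := by
            rw [simple_braid hij]; simp only [mul_assoc]
        _ = w * simple j := by simp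
    rwa [hprod] at hlji

/-- The operators `op i` satisfy the braid relations of the simple transpositions. -/
structure BraidRelations {X : Type*} (op : Fin (n - 1) → X → X) : Prop where
  comm : ∀ {i j : Fin (n - 1)}, i.val + 1 < j.val → ∀ f, op i (op j f) = op j (op i f)
  braid : ∀ {i j : Fin (n - 1)}, i.val + 1 = j.val →
    ∀ f, op i (op j (op i f)) = op j (op i (op j f))

namespace BraidRelations

variable {X : Type*} {op : Fin (n - 1) → X → X} {f : X} {l l' : List (Fin (n - 1))}

theorem foldl_append_singleton_eq (hop : BraidRelations op)
    (ih : ∀ {s : Fin (n - 1)} {u u'}, w (hi s) < w (lo s) → IsReducedWord u (w * simple s) →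
      IsReducedWord u' (w * simple s) →
      u.foldl (fun g t => op t g) f = u'.foldl (fun g t => op t g) f)
    (hij : i < j) (hl : IsReducedWord (l ++ [i]) w) (hl' : IsReducedWord (l' ++ [j]) w) :
    (l ++ [i]).foldl (fun g t => op t g) f = (l' ++ [j]).foldl (fun g t => op t g) f := by
  obtain ⟨hwi, hli⟩ := hl.of_append_singleton
  obtain ⟨hwj, hlj⟩ := hl'.of_append_singleton
  rcases (Nat.succ_le_of_lt hij).eq_or_lt with hadj | hfar
  · obtain ⟨u, hui, huj⟩ := exists_common_prefix_of_adjacent hadj hwi hwj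
    rw [List.foldl_append, List.foldl_append, ih hwi hli hui, ih hwj hlj huj]
    simpa using hop.braid hadj _
  · obtain ⟨u, hui, huj⟩ := exists_common_prefix_of_comm hfar hwi hwj
    rw [List.foldl_append, List.foldl_append, ih hwi hli hui, ih hwj hlj huj]
    simpa using hop.comm hfar _

theorem foldl_eq (hop : BraidRelations op) (hl : IsReducedWord l w) (hl' : IsReducedWord l' w) :
    l.foldl (fun g t => op t g) f = l'.foldl (fun g t => op t g) f := by
  generalize hm : len w = m
  induction m generalizing w l l' with
  | zero =>
    rw [List.length_eq_zero_iff.1 (hl.2.trans hm), List.length_eq_zero_iff.1 (hl'.2.trans hm)]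
  | succ m ih =>
    obtain ⟨u, i, rfl⟩ := List.eq_nil_or_concat' l |>.resolve_left
      fun h => by simp [h, IsReducedWord, hm] at hl
    obtain ⟨u', j, rfl⟩ := List.eq_nil_or_concat' l' |>.resolve_left
      fun h => by simp [h, IsReducedWord, hm] at hl'
    have ih' : ∀ {s : Fin (n - 1)} {u u'}, w (hi s) < w (lo s) → IsReducedWord u (w * simple s) →
        IsReducedWord u' (w * simple s) →
        u.foldl (fun g t => op t g) f = u'.foldl (fun g t => op t g) f := fun hs hu hu' =>
      ih hu hu' (Nat.succ_injective ((len_mul_simple_of_descent hs).trans hm))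
    rcases lt_trichotomy i j with hij | rfl | hij
    · exact hop.foldl_append_singleton_eq ih' hij hl hl'
    · obtain ⟨hwi, hu⟩ := hl.of_append_singleton
      rw [List.foldl_append, List.foldl_append, ih' hwi hu hl'.of_append_singleton.2]
    · exact (hop.foldl_append_singleton_eq ih' hij hl' hl).symm

end BraidRelations

end ReducedWords

/-! ### Isobaric divided differences -/

section Action

theorem ratFun_hom_ext {φ ψ : RatFun n →+* RatFun n} (hx : ∀ i, φ (ratX i) = ψ (ratX i))
    (hy : ∀ i, φ (ratY i) = ψ (ratY i)) : φ = ψ := by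
  refine IsLocalization.ringHom_ext (nonZeroDivisors (MvPolynomial (Fin n ⊕ Fin n) ℤ)) ?_
  refine MvPolynomial.ringHom_ext (fun r => by simp) ?_
  rintro (i | i)
  · exact hx i
  · exact hy i

theorem permX_mul (σ τ : Perm (Fin n)) (f : RatFun n) :
    permX (σ * τ) f = permX σ (permX τ f) :=
  congrArg (fun φ : RatFun n →+* RatFun n => φ f) <|
    ratFun_hom_ext (φ := (permX (σ * τ)).toRingHom)
      (ψ := (permX σ).toRingHom.comp (permX τ).toRingHom)
      (fun i => by simp [permX_ratX]) (fun i => by simp [permX_ratY])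

theorem permX_one (f : RatFun n) : permX (1 : Perm (Fin n)) f = f :=
  congrArg (fun φ : RatFun n →+* RatFun n => φ f) <|
    ratFun_hom_ext (φ := (permX (1 : Perm (Fin n))).toRingHom) (ψ := RingHom.id _)
      (fun i => by simp [permX_ratX]) (fun i => by simp [permX_ratY])

theorem permX_simple_simple (i : Fin (n - 1)) (f : RatFun n) :
    permX (simple i) (permX (simple i) f) = f := by
  rw [← permX_mul, simple_mul_self, permX_one]

theorem ratX_sub_ne_zero {i j : Fin n} (h : i ≠ j) : ratX i - ratX j ≠ 0 :=
  sub_ne_zero.2 (ratX_injective.ne h)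

theorem coe_x (i : Fin n) : ((x i : Laurent n) : RatFun n) = ratX i := rfl

theorem coe_y (i : Fin n) : ((y i : Laurent n) : RatFun n) = ratY i := rfl

theorem coe_xInv (i : Fin n) : ((xInv i : Laurent n) : RatFun n) = (ratX i)⁻¹ := rfl

end Action

section Operators

variable {i j : Fin (n - 1)}

theorem coe_divDiff (i : Fin (n - 1)) (f : Laurent n) :
    (divDiff i f : RatFun n) =
      ((f : RatFun n) - permX (simple i) f) / (ratX (lo i) - ratX (hi i)) := rfl

theorem coe_piOp (i : Fin (n - 1)) (f : Laurent n) :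
    (piOp i f : RatFun n) = (ratX (lo i) * f - ratX (hi i) * permX (simple i) f) /
      (ratX (lo i) - ratX (hi i)) := by
  change ((divDiff i (x (lo i) * f) : Laurent n) : RatFun n) = _
  rw [coe_divDiff, Subalgebra.coe_mul, coe_x, map_mul, permX_ratX, simple_lo]

theorem hatPiOp_eq (i : Fin (n - 1)) (f : Laurent n) : hatPiOp i f = piOp i f - f := by
  apply Subtype.ext
  change ratX (hi i) * (divDiff i f : RatFun n) = _
  rw [Subalgebra.coe_sub, coe_piOp, coe_divDiff]
  have := ratX_sub_ne_zero (lo_ne_hi i)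
  field_simp
  ring

theorem piOp_piOp (i : Fin (n - 1)) (f : Laurent n) : piOp i (piOp i f) = piOp i f := by
  apply Subtype.ext
  rw [coe_piOp, coe_piOp, map_div₀, map_sub, map_sub, map_mul, map_mul, permX_ratX, permX_ratX,
    simple_lo, simple_hi, permX_simple_simple]
  have := ratX_sub_ne_zero (lo_ne_hi i)
  have := ratX_sub_ne_zero (lo_ne_hi i).symm
  field_simp
  ring

theorem piOp_sum {ι : Type*} (i : Fin (n - 1)) (s : Finset ι) (f : ι → Laurent n) :
    piOp i (∑ a ∈ s, f a) = ∑ a ∈ s, piOp i (f a) := by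
  apply Subtype.ext
  simp only [coe_piOp, AddSubmonoidClass.coe_finsetSum, map_sum, mul_sum, ← sum_sub_distrib,
    sum_div]

theorem piOp_mul_of_fixed {g : Laurent n} (hg : permX (simple i) (g : RatFun n) = g)
    (f : Laurent n) : piOp i (g * f) = g * piOp i f := by
  apply Subtype.ext
  rw [Subalgebra.coe_mul, coe_piOp, coe_piOp, Subalgebra.coe_mul, map_mul, hg]
  ring

theorem piOp_sub (i : Fin (n - 1)) (f g : Laurent n) : piOp i (f - g) = piOp i f - piOp i g := by
  apply Subtype.ext
  simp only [coe_piOp, Subalgebra.coe_sub, map_sub]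
  ring

theorem piOp_add (i : Fin (n - 1)) (f g : Laurent n) : piOp i (f + g) = piOp i f + piOp i g := by
  apply Subtype.ext
  simp only [coe_piOp, Subalgebra.coe_add, map_add]
  ring

theorem piOp_comm (h : i.val + 1 < j.val) (f : Laurent n) :
    piOp i (piOp j f) = piOp j (piOp i f) := by
  have hlt : i < j := by omega
  apply Subtype.ext
  simp only [coe_piOp, map_div₀, map_sub, map_mul, permX_ratX, simple_apply_lo_of_lt h,
    simple_apply_hi_of_lt hlt, simple_apply_lo_of_gt hlt, simple_apply_hi_of_gt h, ← permX_mul,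
    simple_comm h]
  have := ratX_sub_ne_zero (lo_ne_hi i)
  have := ratX_sub_ne_zero (lo_ne_hi j)
  field_simp
  ring

theorem piOp_braid (h : i.val + 1 = j.val) (f : Laurent n) :
    piOp i (piOp j (piOp i f)) = piOp j (piOp i (piOp j f)) := by
  have hlt : i < j := by omega
  have hij : lo i ≠ lo j := hi_eq_lo h ▸ lo_ne_hi i
  have hij' : lo i ≠ hi j := Fin.ne_of_val_ne (by simp; omega)
  have hbraid : ∀ g : RatFun n, permX (simple i) (permX (simple j) (permX (simple i) g)) =
      permX (simple j) (permX (simple i) (permX (simple j) g)) := fun g => by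
    simp only [← permX_mul, ← mul_assoc, simple_braid h]
  apply Subtype.ext
  simp only [coe_piOp, map_div₀, map_sub, map_mul, permX_ratX, hi_eq_lo h,
    simple_apply_hi_of_lt hlt, simple_apply_lo_of_gt hlt, simple_apply_lo_of_adjacent h,
    simple_lo, simple_hi, permX_simple_simple, hbraid]
  have := ratX_sub_ne_zero hij
  have := ratX_sub_ne_zero hij.symm
  have := ratX_sub_ne_zero hij'
  have := ratX_sub_ne_zero (lo_ne_hi j)
  have := ratX_sub_ne_zero (lo_ne_hi j).symm
  field_simp
  ring

theorem braidRelations_piOp : BraidRelations (piOp (n := n)) where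
  comm := piOp_comm
  braid := piOp_braid

theorem piPerm_eq_foldl {l : List (Fin (n - 1))} {w : Perm (Fin n)} (hl : IsReducedWord l w)
    (f : Laurent n) : piPerm w f = l.foldl (fun g i => piOp i g) f :=
  braidRelations_piOp.foldl_eq (isReducedWord_reducedWord w) hl

theorem piPerm_one (f : Laurent n) : piPerm 1 f = f := by
  rw [piPerm, reducedWord_one, List.foldl_nil]

theorem piPerm_mul_simple {w : Perm (Fin n)} (h : w (lo i) < w (hi i)) (f : Laurent n) :
    piPerm (w * simple i) f = piOp i (piPerm w f) := by
  obtain ⟨l, hl⟩ := exists_reducedWord w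
  rw [piPerm_eq_foldl (hl.append_singleton h), piPerm_eq_foldl hl, List.foldl_append]
  rfl

end Operators

section Grothendieck

variable {μ : Perm (Fin n)} {i : Fin (n - 1)}

theorem omega_lt_omega {a b : Fin n} : omega n a < omega n b ↔ b < a := by
  simp [omega]

theorem omega_mul_omega : omega n * omega n = 1 := by
  ext
  simp [omega]

theorem groth_omega : groth (omega n) = grothOmega n := by
  rw [groth, omega_mul_omega, piPerm_one]

theorem piOp_groth_of_descent (h : μ (hi i) < μ (lo i)) :
    piOp i (groth μ) = groth (μ * simple i) := by
  rw [groth, groth, ← mul_assoc, piPerm_mul_simple]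
  exact omega_lt_omega.2 h

theorem piOp_groth_of_ascent (h : μ (lo i) < μ (hi i)) : piOp i (groth μ) = groth μ := by
  have hdescent := piOp_groth_of_descent (μ := μ * simple i) (i := i) (by simpa using h)
  rw [mul_simple_mul_simple] at hdescent
  rw [← hdescent, piOp_piOp]

end Grothendieck

/-! ### Signed sums of Grothendieck polynomials -/

open Classical in
/-- The sum of `(-1) ^ (ℓ(μ) + m) G_μ` over the permutations `μ` with property `P`. Taking
`m = ℓ(σ)` gives the signs `(-1) ^ (ℓ(μ) - ℓ(σ))` without a truncated subtraction. -/
noncomputable def signedSum (P : Perm (Fin n) → Prop) (m : ℕ) : Laurent n :=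
  ∑ μ with P μ, (-1) ^ (len μ + m) * groth μ

section SignedSum

variable {P Q : Perm (Fin n) → Prop} {i : Fin (n - 1)}

theorem signedSum_congr (h : ∀ μ, P μ ↔ Q μ) (m : ℕ) : signedSum P m = signedSum Q m :=
  congrArg (signedSum · m) (funext fun μ => propext (h μ))

theorem signedSum_or (h : ∀ μ, P μ → ¬ Q μ) (m : ℕ) :
    signedSum (fun μ => P μ ∨ Q μ) m = signedSum P m + signedSum Q m := by
  classical
  simp only [signedSum]
  rw [← sum_union (disjoint_filter.2 fun μ _ => h μ), ← filter_or]

theorem signedSum_succ (P : Perm (Fin n) → Prop) (m : ℕ) :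
    signedSum P (m + 1) = -signedSum P m := by
  rw [signedSum, signedSum, ← sum_neg_distrib]
  refine sum_congr rfl fun μ _ => ?_
  rw [← add_assoc, pow_succ]
  ring

theorem signedSum_eq_self (μ : Perm (Fin n)) : signedSum (· = μ) (len μ) = groth μ := by
  have hsign : (-1 : Laurent n) ^ (len μ + len μ) = 1 :=
    Subtype.ext (Even.add_self _).neg_one_pow
  rw [signedSum, sum_eq_single μ (by simp) (by simp), hsign]
  exact one_mul _

theorem piOp_neg_one_pow_mul (i : Fin (n - 1)) (m : ℕ) (f : Laurent n) :
    piOp i ((-1) ^ m * f) = (-1) ^ m * piOp i f :=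
  piOp_mul_of_fixed (by simp) f

theorem piOp_signedSum_of_ascent (hP : ∀ μ, P μ → μ (lo i) < μ (hi i)) (m : ℕ) :
    piOp i (signedSum P m) = signedSum P m := by
  classical
  rw [signedSum, piOp_sum]
  refine sum_congr rfl fun μ hμ => ?_
  rw [piOp_neg_one_pow_mul, piOp_groth_of_ascent (hP μ (mem_filter.1 hμ).2)]

theorem piOp_signedSum_of_descent (hP : ∀ μ, P μ → μ (hi i) < μ (lo i)) (m : ℕ) :
    piOp i (signedSum P (m + 1)) = signedSum (fun ν => P (ν * simple i)) m := by
  classical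
  rw [signedSum, signedSum, piOp_sum]
  refine sum_nbij' (· * simple i) (· * simple i) ?_ ?_ ?_ ?_ fun μ hμ => ?_
  any_goals intro μ; simp
  have hdescent := hP μ (mem_filter.1 hμ).2
  have hsign : len μ + (m + 1) = len (μ * simple i) + m + 2 := by
    have := len_mul_simple_of_descent hdescent
    omega
  rw [piOp_neg_one_pow_mul, piOp_groth_of_descent hdescent, hsign, pow_add]
  simp

theorem piOp_signedSum (hP : ∀ μ, P μ → μ (lo i) < μ (hi i) → P (μ * simple i)) (m : ℕ) :
    piOp i (signedSum P (m + 1)) =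
      signedSum (fun ν => ν (lo i) < ν (hi i) ∧ P (ν * simple i) ∧ ¬ P ν) m := by
  set Asc : Perm (Fin n) → Prop := fun μ => P μ ∧ μ (lo i) < μ (hi i)
  set Desc : Perm (Fin n) → Prop := fun μ => P μ ∧ μ (hi i) < μ (lo i)
  have hsplit : signedSum P (m + 1) = signedSum Asc (m + 1) + signedSum Desc (m + 1) := by
    rw [← signedSum_or fun μ h h' => lt_asymm h.2 h'.2]
    exact signedSum_congr (fun μ => by have := ascent_or_descent μ i; tauto) _
  have hshift : signedSum (fun ν => Desc (ν * simple i)) m = signedSum Asc m +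
      signedSum (fun ν => ν (lo i) < ν (hi i) ∧ P (ν * simple i) ∧ ¬ P ν) m := by
    rw [← signedSum_or fun μ h h' => h'.2.2 h.1]
    refine signedSum_congr (fun μ => ?_) _
    have := hP μ
    simp only [Desc, Perm.mul_apply, simple_lo, simple_hi]
    tauto
  rw [hsplit, piOp_add, piOp_signedSum_of_ascent fun μ h => h.2,
    piOp_signedSum_of_descent fun μ h => h.2, hshift, signedSum_succ]
  ring

end SignedSum

section HatPi

variable {σ ν : Perm (Fin n)} {i : Fin (n - 1)}

theorem rk_mul_simple_of_ne (w : Perm (Fin n)) {p : ℕ} (hp : p ≠ i.val + 1) (q : ℕ) :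
    rk (w * simple i) p q = rk w p q := by
  have hnot : ¬ ((lo i).val < p ∧ p ≤ (hi i).val) := by simp only [lo_val, hi_val]; omega
  rw [simple_eq_swap]
  rcases ascent_or_descent w i with h | h
  · rw [rk_mul_swap (lo_lt_hi i) h, if_neg fun hc => hnot ⟨hc.1, hc.2.1⟩, add_zero]
  · rw [rk_eq_rk_mul_swap_add (lo_lt_hi i) h, if_neg fun hc => hnot ⟨hc.1, hc.2.1⟩, add_zero]

theorem rkLE_of_forall_ne (h : ∀ p, p ≠ i.val + 1 → ∀ q, rk σ p q ≤ rk ν p q)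
    (hi : σ (lo i) < σ (hi i) ∨ ν (hi i) < ν (lo i)) : RkLE σ ν := by
  intro p q
  by_cases hp : p = i.val + 1
  · have hσlo := rk_succ σ (lo i) q
    have hσhi := rk_succ σ (GrothPieri.hi i) q
    have hνlo := rk_succ ν (lo i) q
    have hνhi := rk_succ ν (GrothPieri.hi i) q
    have hbefore := h i.val (by omega) q
    have hafter := h (i.val + 1 + 1) (by omega) q
    simp only [lo_val, hi_val] at hσlo hσhi hνlo hνhi
    rw [hp]
    split_ifs at hσlo hσhi hνlo hνhi <;> omega
  · exact h p hp q

theorem RkLE.mul_simple_left (h : RkLE σ ν) (hν : ν (hi i) < ν (lo i)) :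
    RkLE (σ * simple i) ν :=
  rkLE_of_forall_ne (i := i) (fun p hp q => (rk_mul_simple_of_ne σ hp q).trans_le (h p q))
    (Or.inr hν)

theorem RkLE.of_mul_simple (h : RkLE (σ * simple i) (ν * simple i))
    (hσ : σ (lo i) < σ (hi i)) : RkLE σ ν := by
  refine rkLE_of_forall_ne (i := i) (fun p hp q => ?_) (Or.inl hσ)
  simpa only [rk_mul_simple_of_ne _ hp] using h p q

theorem rkLE_mul_simple (h : σ (lo i) < σ (hi i)) : RkLE σ (σ * simple i) :=
  rkLE_mul_swap (lo_lt_hi i) h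

theorem rkLE_iff_of_ascent (hσ : σ (lo i) < σ (hi i)) :
    RkLE σ ν ↔ (RkLE (σ * simple i) ν ∨
      (ν (lo i) < ν (hi i) ∧ RkLE (σ * simple i) (ν * simple i) ∧ ¬ RkLE (σ * simple i) ν)) := by
  constructor
  · intro h
    refine or_iff_not_imp_left.2 fun hnot => ?_
    rcases ascent_or_descent ν i with hν | hν
    · exact ⟨hν, (h.trans (rkLE_mul_simple hν)).mul_simple_left (by simpa using hν), hnot⟩
    · exact absurd (h.mul_simple_left hν) hnot
  · rintro (h | ⟨-, h, -⟩)
    · exact (rkLE_mul_simple hσ).trans h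
    · exact h.of_mul_simple hσ

theorem rkLE_omega_iff {μ : Perm (Fin n)} : RkLE (omega n) μ ↔ μ = omega n := by
  refine ⟨fun h => ?_, fun h => h ▸ RkLE.refl _⟩
  by_contra hne
  obtain ⟨a, b, hab, hω, -⟩ := h.exists_cover (Ne.symm hne)
  exact lt_asymm hab (omega_lt_omega.1 hω)

theorem foldl_hatPiOp_grothOmega {l : List (Fin (n - 1))} {w : Perm (Fin n)}
    (hl : IsReducedWord l w) : l.foldl (fun g i => hatPiOp i g) (grothOmega n) =
      signedSum (RkLE (omega n * w)) (len (omega n * w)) := by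
  induction l using List.reverseRecOn generalizing w with
  | nil =>
    have hw : w = 1 := hl.1.symm
    rw [hw, mul_one, signedSum_congr fun μ => rkLE_omega_iff, signedSum_eq_self, groth_omega,
      List.foldl_nil]
  | append_singleton l i ih =>
    obtain ⟨hdescent, hl'⟩ := hl.of_append_singleton
    have hascent : (omega n * w) (lo i) < (omega n * w) (hi i) := omega_lt_omega.2 hdescent
    rw [List.foldl_append, ih hl', ← mul_assoc, List.foldl_cons, List.foldl_nil, hatPiOp_eq,
      len_mul_simple_of_ascent hascent, piOp_signedSum fun μ h hμ => h.trans (rkLE_mul_simple hμ),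
      signedSum_succ, sub_neg_eq_add, add_comm, ← signedSum_or fun μ h h' => h'.2.2 h]
    exact signedSum_congr (fun μ => (rkLE_iff_of_ascent hascent).symm) _

theorem hatPiPerm_grothOmega (w : Perm (Fin n)) :
    hatPiPerm w (grothOmega n) = signedSum (RkLE (omega n * w)) (len (omega n * w)) :=
  foldl_hatPiOp_grothOmega (isReducedWord_reducedWord w)

end HatPi

/-! ### Maximal coset representatives -/

/-- The entries of `ζ` decrease on the first `k` positions and on the remaining ones. This
characterizes the Bruhat-greatest element of a coset of `S_k × S_{n-k}`. -/
def BlockDecreasing (k : ℕ) (ζ : Perm (Fin n)) : Prop :=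
  ∀ a b : Fin n, a < b → (b.val < k ∨ k ≤ a.val) → ζ b < ζ a

section BlockDecreasing

variable {k : ℕ} {σ τ ζ μ : Perm (Fin n)} {p q : ℕ}

theorem rk_le_of_forall_le_apply (h : ∀ c : Fin n, c.val < p → q ≤ (ζ c).val) :
    rk μ p q ≤ rk ζ p q :=
  card_le_card <| monotone_filter_right _ fun c _ hc => ⟨hc.1, h c hc.1⟩

theorem rk_le_of_forall_apply_lt (h : ∀ c : Fin n, p ≤ c.val → (ζ c).val < q) :
    rk μ p q ≤ rk ζ p q := by
  have hζ : rk ζ (p + n) q = rk ζ p q := by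
    rw [rk_eq_rk_add_card_segment ζ (p.le_add_right n), Nat.add_eq_left, card_eq_zero,
      filter_eq_empty_iff]
    rintro c - ⟨hpc, -, hq⟩
    exact (h c hpc).not_ge hq
  rw [← hζ, rk_of_le ζ μ (by omega), rk_eq_rk_add_card_segment μ (p.le_add_right n)]
  exact Nat.le_add_right _ _

theorem BlockDecreasing.isPieri_iff (h : BlockDecreasing k ζ) : IsPieri k ζ μ ↔ RkLE ζ μ := by
  refine ⟨IsPieri.rkLE, fun hle c => ⟨fun hc => ⟨hle.le_apply ?_, fun p hcp hpk hζ => ?_⟩,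
    fun hc => ⟨hle.apply_le ?_, fun p hkp hpc hζ => ?_⟩⟩⟩
  · refine le_antisymm (rk_le_of_forall_le_apply fun d hd => ?_) (hle _ _)
    exact (h d c hd (Or.inl hc)).le
  · exact absurd (h c p hcp (Or.inl hpk)) hζ.not_gt
  · refine le_antisymm (rk_le_of_forall_apply_lt fun d hd => ?_) (hle _ _)
    exact Nat.lt_succ_of_lt (h c d hd (Or.inr hc))
  · exact absurd (h p c hpc (Or.inr hkp)) hζ.not_gt

theorem swap_mem_youngSubgroup {a b : Fin n} (h : a.val < k ↔ b.val < k) :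
    swap a b ∈ youngSubgroup n k := by
  intro c
  rw [swap_apply_def]
  split_ifs with hca hcb
  · rw [hca, h]
  · rw [hcb, h]
  · rfl

theorem exists_blockDecreasing (k : ℕ) (σ : Perm (Fin n)) :
    ∃ τ ∈ youngSubgroup n k, BlockDecreasing k (σ * τ) := by
  obtain ⟨τ, hτ, hmax⟩ := (youngSubgroup n k : Set (Perm (Fin n))).toFinite.exists_maximalFor
    (fun τ => len (σ * τ)) _ ⟨1, one_mem _⟩
  refine ⟨τ, hτ, fun a b hab hk => ?_⟩
  by_contra! hle
  have hlen := len_lt_len_mul_swap hab (hle.lt_of_ne ((σ * τ).injective.ne hab.ne))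
  rw [mul_assoc] at hlen
  exact hlen.not_ge
    (hmax (mul_mem hτ (swap_mem_youngSubgroup (by omega : a.val < k ↔ b.val < k))) hlen.le)

theorem rk_mul_of_mem_youngSubgroup (h : τ ∈ youngSubgroup n k) (q : ℕ) :
    rk (σ * τ) k q = rk σ k q := by
  rw [rk, rk]
  refine card_equiv τ fun c => ?_
  rw [mem_filter, mem_filter, Perm.mul_apply, h c]
  simp

theorem BlockDecreasing.rkLE (h : BlockDecreasing k ζ) (hμ : ∀ q, rk μ k q = rk ζ k q) :
    RkLE μ ζ := by
  intro p q
  rcases le_total p k with hp | hp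
  · by_cases hall : ∀ c : Fin n, c.val < p → q ≤ (ζ c).val
    · exact rk_le_of_forall_le_apply hall
    push Not at hall
    obtain ⟨c, hcp, hcq⟩ := hall
    have hsegment : #{d : Fin n | p ≤ d.val ∧ d.val < k ∧ q ≤ (ζ d).val} = 0 := by
      rw [card_eq_zero, filter_eq_empty_iff]
      rintro d - ⟨hpd, hdk, hqd⟩
      have := h c d (by omega) (Or.inl hdk)
      omega
    have := hμ q
    rw [rk_eq_rk_add_card_segment μ hp, rk_eq_rk_add_card_segment ζ hp] at this
    omega
  · by_cases hall : ∀ c : Fin n, p ≤ c.val → (ζ c).val < q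
    · exact rk_le_of_forall_apply_lt hall
    push Not at hall
    obtain ⟨c, hpc, hqc⟩ := hall
    rw [rk_eq_rk_add_card_segment μ hp, rk_eq_rk_add_card_segment ζ hp, hμ]
    refine Nat.add_le_add_left (card_le_card <| monotone_filter_right _ fun d _ hd => ?_) _
    have := h d c (by omega) (Or.inr hd.1)
    exact ⟨hd.1, hd.2.1, by omega⟩

theorem BlockDecreasing.isCosetMax (hτ : τ ∈ youngSubgroup n k)
    (h : BlockDecreasing k (σ * τ)) : IsCosetMax k σ (σ * τ) := by
  refine ⟨⟨τ, hτ, rfl⟩, fun ρ hρ => (h.rkLE fun q => ?_).bruhatLE⟩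
  rw [rk_mul_of_mem_youngSubgroup hρ, rk_mul_of_mem_youngSubgroup hτ]

end BlockDecreasing

/-! ### The Pieri set under removal of a descent -/

section Descent

variable {k : ℕ} {σ ν : Perm (Fin n)} {i : Fin (n - 1)} {c p s t : Fin n}

theorem lt_simple_iff (hlo : c ≠ lo i) (hhi : c ≠ hi i) : c < simple i p ↔ c < p := by
  simp only [simple_eq_swap, swap_apply_def]
  split_ifs <;> simp only [Fin.lt_def, Fin.ext_iff, Ne, lo_val, hi_val] at * <;> omega

theorem simple_lt_iff (hlo : c ≠ lo i) (hhi : c ≠ hi i) : simple i p < c ↔ p < c := by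
  simp only [simple_eq_swap, swap_apply_def]
  split_ifs <;> simp only [Fin.lt_def, Fin.ext_iff, Ne, lo_val, hi_val] at * <;> omega

theorem forall_gt_lo_iff {P : Fin n → Prop} :
    (∀ p, lo i < p → P p) ↔ P (hi i) ∧ ∀ p, hi i < p → P p := by
  refine ⟨fun h => ⟨h _ (lo_lt_hi i), fun p hp => h p ((lo_lt_hi i).trans hp)⟩, fun h p hp => ?_⟩
  obtain rfl | hp := (Fin.le_def.2 hp : hi i ≤ p).eq_or_lt
  exacts [h.1, h.2 p hp]

theorem forall_ge_lt_hi_iff {P : Fin n → Prop} (hk : k ≤ i.val) :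
    (∀ p : Fin n, k ≤ p.val → p < hi i → P p) ↔
      P (lo i) ∧ ∀ p : Fin n, k ≤ p.val → p < lo i → P p := by
  refine ⟨fun h => ⟨h _ hk (lo_lt_hi i), fun p hkp hp => h p hkp (hp.trans (lo_lt_hi i))⟩,
    fun h p hkp hp => ?_⟩
  obtain rfl | hp := (Fin.le_def.2 (Nat.lt_succ_iff.1 hp) : p ≤ lo i).eq_or_lt
  exacts [h.1, h.2 p hkp hp]

theorem forall_iff_of_lo_hi {P : Fin n → Prop} :
    (∀ c, P c) ↔ (∀ c, c ≠ lo i → c ≠ hi i → P c) ∧ P (lo i) ∧ P (hi i) := by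
  refine ⟨fun h => ⟨fun c _ _ => h c, h _, h _⟩, fun h c => ?_⟩
  rcases eq_or_ne c (lo i) with rfl | hlo
  · exact h.2.1
  rcases eq_or_ne c (hi i) with rfl | hhi
  · exact h.2.2
  exact h.1 c hlo hhi

theorem simple_mem_youngSubgroup (hik : i.val + 1 ≠ k) : simple i ∈ youngSubgroup n k :=
  swap_mem_youngSubgroup (a := lo i) (b := hi i) (by simp only [lo_val, hi_val]; omega)

theorem allowed_mul_simple_of_ne (hik : i.val + 1 ≠ k) (hlo : c ≠ lo i) (hhi : c ≠ hi i) :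
    Allowed k (σ * simple i) c t ↔ Allowed k σ c t := by
  have hblock := simple_mem_youngSubgroup (n := n) hik
  simp only [Allowed, Perm.mul_apply, simple_apply_of_ne hlo hhi]
  refine and_congr (imp_congr_right fun _ => and_congr_right fun _ => ?_)
    (imp_congr_right fun _ => and_congr_right fun _ => ?_)
  · refine (simple i).forall_congr fun p => ?_
    rw [lt_simple_iff hlo hhi, hblock p]
  · refine (simple i).forall_congr fun p => ?_
    rw [simple_lt_iff hlo hhi, ← not_lt, ← not_lt, hblock p]

theorem allowed_hi_iff_of_lt (hk : i.val + 1 < k) : Allowed k σ (hi i) t ↔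
    σ (hi i) ≤ t ∧ ∀ p : Fin n, hi i < p → p.val < k → σ (hi i) < σ p → t < σ p :=
  allowed_iff_of_lt hk

theorem allowed_lo_iff_of_lt (hk : i.val + 1 < k) (hd : σ (hi i) < σ (lo i)) :
    Allowed k σ (lo i) t ↔
    σ (lo i) ≤ t ∧ ∀ p : Fin n, hi i < p → p.val < k → σ (lo i) < σ p → t < σ p := by
  rw [allowed_iff_of_lt (Nat.lt_of_succ_lt hk : (lo i).val < k), forall_gt_lo_iff]
  simp only [hd.not_gt, false_imp_iff, implies_true, true_and]

theorem allowed_mul_simple_lo_of_lt (hk : i.val + 1 < k) (hd : σ (hi i) < σ (lo i)) :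
    Allowed k (σ * simple i) (lo i) s ↔ Allowed k σ (hi i) s ∧ s < σ (lo i) := by
  rw [allowed_iff_of_lt (Nat.lt_of_succ_lt hk : (lo i).val < k), forall_gt_lo_iff,
    allowed_hi_iff_of_lt hk]
  have htail : (∀ p : Fin n, hi i < p → p.val < k → (σ * simple i) (lo i) < (σ * simple i) p →
      s < (σ * simple i) p) ↔ ∀ p : Fin n, hi i < p → p.val < k → σ (hi i) < σ p → s < σ p :=
    forall₂_congr fun p hp => by
      rw [mul_simple_apply_of_ne ((lo_lt_hi i).trans hp).ne' hp.ne', Perm.mul_apply, simple_lo]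
  rw [htail]
  simp only [Perm.mul_apply, simple_lo, simple_hi, hd, true_imp_iff, hi_val, hk]
  tauto

theorem allowed_mul_simple_hi_of_lt (hk : i.val + 1 < k) (hd : σ (hi i) < σ (lo i)) :
    Allowed k (σ * simple i) (hi i) t ↔ Allowed k σ (lo i) t := by
  rw [allowed_hi_iff_of_lt hk, allowed_lo_iff_of_lt hk hd, Perm.mul_apply, simple_hi]
  exact and_congr_right fun _ => forall₂_congr fun p hp => by
    rw [mul_simple_apply_of_ne ((lo_lt_hi i).trans hp).ne' hp.ne']

theorem allowed_exchange_of_lt (hk : i.val + 1 < k) (hd : σ (hi i) < σ (lo i))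
    (hst : s < t) (hlo : Allowed k σ (lo i) s)
    (hhi : Allowed k σ (hi i) t) : Allowed k σ (lo i) t ∧ Allowed k σ (hi i) s := by
  rw [allowed_lo_iff_of_lt hk hd] at hlo ⊢
  rw [allowed_hi_iff_of_lt hk] at hhi ⊢
  exact ⟨⟨hlo.1.trans hst.le, fun p hp hpk hσ => hhi.2 p hp hpk (hd.trans hσ)⟩,
    hd.le.trans hlo.1, fun p hp hpk hσ => hst.trans (hhi.2 p hp hpk hσ)⟩

theorem allowed_of_le_of_lt (hk : i.val + 1 < k) (hd : σ (hi i) < σ (lo i))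
    (hst : s < t) (hs : Allowed k σ (hi i) s) (ht : Allowed k σ (lo i) t)
    (hle : σ (lo i) ≤ s) : Allowed k σ (lo i) s ∧ Allowed k σ (hi i) t := by
  rw [allowed_lo_iff_of_lt hk hd] at ht ⊢
  rw [allowed_hi_iff_of_lt hk] at hs ⊢
  exact ⟨⟨hle, fun p hp hpk hσ => hst.trans (ht.2 p hp hpk hσ)⟩, hs.1.trans hst.le,
    fun p hp hpk hσ => ht.2 p hp hpk (hle.trans_lt (hs.2 p hp hpk hσ))⟩

theorem allowed_mul_simple_iff_of_lt (hk : i.val + 1 < k) (hd : σ (hi i) < σ (lo i)) :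
    (Allowed k (σ * simple i) (lo i) s ∧ Allowed k (σ * simple i) (hi i) t) ↔
      s < t ∧ Allowed k σ (hi i) s ∧ Allowed k σ (lo i) t ∧
        ¬ (Allowed k σ (lo i) s ∧ Allowed k σ (hi i) t) := by
  rw [allowed_mul_simple_lo_of_lt hk hd, allowed_mul_simple_hi_of_lt hk hd]
  constructor
  · rintro ⟨⟨hs, hlt⟩, ht⟩
    exact ⟨hlt.trans_le ((allowed_lo_iff_of_lt hk hd).1 ht).1, hs, ht,
      fun h => hlt.not_ge ((allowed_lo_iff_of_lt hk hd).1 h.1).1⟩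
  · rintro ⟨hst, hs, ht, hnot⟩
    exact ⟨⟨hs, not_le.1 fun hle => hnot (allowed_of_le_of_lt hk hd hst hs ht hle)⟩, ht⟩

theorem allowed_lo_iff_of_ge (hk : k < i.val + 1) : Allowed k σ (lo i) t ↔
    t ≤ σ (lo i) ∧ ∀ p : Fin n, k ≤ p.val → p < lo i → σ p < σ (lo i) → σ p < t :=
  allowed_iff_of_ge (Nat.lt_succ_iff.1 hk : k ≤ (lo i).val)

theorem allowed_hi_iff_of_ge (hk : k < i.val + 1) (hd : σ (hi i) < σ (lo i)) :
    Allowed k σ (hi i) t ↔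
    t ≤ σ (hi i) ∧ ∀ p : Fin n, k ≤ p.val → p < lo i → σ p < σ (hi i) → σ p < t := by
  rw [allowed_iff_of_ge (hk.le : k ≤ (hi i).val), forall_ge_lt_hi_iff (Nat.lt_succ_iff.1 hk)]
  simp only [hd.not_gt, false_imp_iff, true_and]

theorem allowed_mul_simple_hi_of_ge (hk : k < i.val + 1) (hd : σ (hi i) < σ (lo i)) :
    Allowed k (σ * simple i) (hi i) t ↔ Allowed k σ (lo i) t ∧ σ (hi i) < t := by
  rw [allowed_iff_of_ge (hk.le : k ≤ (hi i).val), forall_ge_lt_hi_iff (Nat.lt_succ_iff.1 hk),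
    allowed_lo_iff_of_ge hk]
  have htail : (∀ p : Fin n, k ≤ p.val → p < lo i → (σ * simple i) p < (σ * simple i) (hi i) →
      (σ * simple i) p < t) ↔ ∀ p : Fin n, k ≤ p.val → p < lo i → σ p < σ (lo i) → σ p < t :=
    forall₃_congr fun p _ hp => by
      rw [mul_simple_apply_of_ne hp.ne (hp.trans (lo_lt_hi i)).ne, Perm.mul_apply, simple_hi]
  rw [htail]
  simp only [Perm.mul_apply, simple_lo, simple_hi, hd, true_imp_iff]
  tauto

theorem allowed_mul_simple_lo_of_ge (hk : k < i.val + 1) (hd : σ (hi i) < σ (lo i)) :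
    Allowed k (σ * simple i) (lo i) s ↔ Allowed k σ (hi i) s := by
  rw [allowed_lo_iff_of_ge hk, allowed_hi_iff_of_ge hk hd, Perm.mul_apply, simple_lo]
  exact and_congr_right fun _ => forall₃_congr fun p _ hp => by
    rw [mul_simple_apply_of_ne hp.ne (hp.trans (lo_lt_hi i)).ne]

theorem allowed_exchange_of_ge (hk : k < i.val + 1) (hd : σ (hi i) < σ (lo i))
    (hst : s < t) (hlo : Allowed k σ (lo i) s)
    (hhi : Allowed k σ (hi i) t) : Allowed k σ (lo i) t ∧ Allowed k σ (hi i) s := by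
  rw [allowed_lo_iff_of_ge hk] at hlo ⊢
  rw [allowed_hi_iff_of_ge hk hd] at hhi ⊢
  exact ⟨⟨hhi.1.trans hd.le, fun p hkp hp hσ => (hlo.2 p hkp hp hσ).trans hst⟩,
    hst.le.trans hhi.1, fun p hkp hp hσ => hlo.2 p hkp hp (hσ.trans hd)⟩

theorem allowed_of_le_of_ge (hk : k < i.val + 1) (hd : σ (hi i) < σ (lo i))
    (hst : s < t) (hs : Allowed k σ (hi i) s) (ht : Allowed k σ (lo i) t)
    (hle : t ≤ σ (hi i)) : Allowed k σ (lo i) s ∧ Allowed k σ (hi i) t := by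
  rw [allowed_lo_iff_of_ge hk] at ht ⊢
  rw [allowed_hi_iff_of_ge hk hd] at hs ⊢
  exact ⟨⟨hst.le.trans ht.1, fun p hkp hp hσ => hs.2 p hkp hp ((ht.2 p hkp hp hσ).trans_le hle)⟩,
    hle, fun p hkp hp hσ => (hs.2 p hkp hp hσ).trans hst⟩

theorem allowed_mul_simple_iff_of_ge (hk : k < i.val + 1) (hd : σ (hi i) < σ (lo i)) :
    (Allowed k (σ * simple i) (lo i) s ∧ Allowed k (σ * simple i) (hi i) t) ↔
      s < t ∧ Allowed k σ (hi i) s ∧ Allowed k σ (lo i) t ∧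
        ¬ (Allowed k σ (lo i) s ∧ Allowed k σ (hi i) t) := by
  rw [allowed_mul_simple_lo_of_ge hk hd, allowed_mul_simple_hi_of_ge hk hd]
  constructor
  · rintro ⟨hs, ht, hlt⟩
    exact ⟨((allowed_hi_iff_of_ge hk hd).1 hs).1.trans_lt hlt, hs, ht,
      fun h => hlt.not_ge ((allowed_hi_iff_of_ge hk hd).1 h.2).1⟩
  · rintro ⟨hst, hs, ht, hnot⟩
    exact ⟨hs, ht, not_le.1 fun hle => hnot (allowed_of_le_of_ge hk hd hst hs ht hle)⟩

theorem isPieri_mul_simple_right :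
    IsPieri k σ (ν * simple i) ↔ (∀ c, c ≠ lo i → c ≠ hi i → Allowed k σ c (ν c)) ∧
      Allowed k σ (lo i) (ν (hi i)) ∧ Allowed k σ (hi i) (ν (lo i)) := by
  rw [IsPieri, forall_iff_of_lo_hi (i := i)]
  simp only [Perm.mul_apply, simple_lo, simple_hi]
  exact and_congr_left fun _ => forall₃_congr fun c hlo hhi => by rw [simple_apply_of_ne hlo hhi]

theorem IsPieri.mul_simple (hik : i.val + 1 ≠ k) (hd : σ (hi i) < σ (lo i)) (h : IsPieri k σ ν)
    (hν : ν (lo i) < ν (hi i)) : IsPieri k σ (ν * simple i) := by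
  refine isPieri_mul_simple_right.2 ⟨fun c _ _ => h c, ?_⟩
  rcases lt_or_gt_of_ne hik with hk | hk
  · exact allowed_exchange_of_lt hk hd hν (h _) (h _)
  · exact allowed_exchange_of_ge hk hd hν (h _) (h _)

theorem isPieri_mul_simple_left (hik : i.val + 1 ≠ k) (hd : σ (hi i) < σ (lo i)) :
    IsPieri k (σ * simple i) ν ↔
      ν (lo i) < ν (hi i) ∧ IsPieri k σ (ν * simple i) ∧ ¬ IsPieri k σ ν := by
  have hpair : (Allowed k (σ * simple i) (lo i) (ν (lo i)) ∧
      Allowed k (σ * simple i) (hi i) (ν (hi i))) ↔ _ :=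
    (lt_or_gt_of_ne hik).elim (fun hk => allowed_mul_simple_iff_of_lt hk hd)
      fun hk => allowed_mul_simple_iff_of_ge hk hd
  have hrest : (∀ c, c ≠ lo i → c ≠ hi i → Allowed k (σ * simple i) c (ν c)) ↔
      ∀ c, c ≠ lo i → c ≠ hi i → Allowed k σ c (ν c) :=
    forall₃_congr fun c hlo hhi => allowed_mul_simple_of_ne hik hlo hhi
  rw [isPieri_mul_simple_right, IsPieri, IsPieri,
    forall_iff_of_lo_hi (i := i) (P := fun c => Allowed k (σ * simple i) c (ν c)),
    forall_iff_of_lo_hi (i := i) (P := fun c => Allowed k σ c (ν c)), hpair, hrest]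
  tauto

theorem piOp_signedSum_isPieri (hik : i.val + 1 ≠ k) (hd : σ (hi i) < σ (lo i)) :
    piOp i (signedSum (IsPieri k σ) (len σ)) =
      signedSum (IsPieri k (σ * simple i)) (len (σ * simple i)) := by
  rw [← len_mul_simple_of_descent hd, piOp_signedSum fun μ h hμ => h.mul_simple hik hd hμ]
  exact signedSum_congr (fun ν => (isPieri_mul_simple_left hik hd).symm) _

end Descent

section CosetInduction

variable {k : ℕ} {ζ u : Perm (Fin n)}

theorem descent_ne_of_mem_youngSubgroup (hu : u ∈ youngSubgroup n k) {i : Fin (n - 1)}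
    (hd : u (hi i) < u (lo i)) : i.val + 1 ≠ k := by
  intro hik
  have hlo := (hu (lo i)).2 (by simp only [lo_val]; omega)
  have hhi := (hu (hi i)).1.mt (by simp only [hi_val]; omega)
  omega

theorem BlockDecreasing.apply_hi_lt (hζ : BlockDecreasing k ζ) (hu : u ∈ youngSubgroup n k)
    {i : Fin (n - 1)} (hik : i.val + 1 ≠ k) (h : u (lo i) < u (hi i)) :
    (ζ * u) (hi i) < (ζ * u) (lo i) := by
  refine hζ _ _ h ?_
  have hlo := hu (lo i)
  have hhi := hu (hi i)
  simp only [lo_val, hi_val] at hlo hhi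
  omega

/- A reduced word of an element of `S_k × S_{n-k}` leads from `ζ` down to any other element of the
coset, each letter removing a descent within one of the two blocks. -/
theorem BlockDecreasing.piPerm_induction (hζ : BlockDecreasing k ζ) {f : Laurent n}
    {motive : Perm (Fin n) → Laurent n → Prop} (base : motive ζ f)
    (step : ∀ (σ : Perm (Fin n)) (g : Laurent n) (i : Fin (n - 1)), i.val + 1 ≠ k →
      σ (hi i) < σ (lo i) → motive σ g → motive (σ * simple i) (piOp i g))
    (hu : u ∈ youngSubgroup n k) : motive (ζ * u) (piPerm u f) := by
  obtain ⟨l, hl⟩ := exists_reducedWord u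
  rw [piPerm_eq_foldl hl]
  induction l using List.reverseRecOn generalizing u with
  | nil =>
    have hu1 : u = 1 := hl.1.symm
    rwa [hu1, mul_one]
  | append_singleton l i ih =>
    obtain ⟨hd, hl'⟩ := hl.of_append_singleton
    have hik := descent_ne_of_mem_youngSubgroup hu hd
    have hu' := mul_mem hu (simple_mem_youngSubgroup (n := n) hik)
    have hnext := step _ _ i hik (hζ.apply_hi_lt hu' hik (by simpa using hd)) (ih hu' hl')
    rwa [mul_assoc, mul_simple_mul_simple, ← List.foldl_concat (f := fun g i => piOp i g)] at hnext

theorem BlockDecreasing.piPerm_signedSum (hζ : BlockDecreasing k ζ)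
    (hu : u ∈ youngSubgroup n k) : piPerm u (signedSum (RkLE ζ) (len ζ)) =
      signedSum (IsPieri k (ζ * u)) (len (ζ * u)) := by
  refine hζ.piPerm_induction
    (motive := fun σ g => g = signedSum (IsPieri k σ) (len σ)) ?_ ?_ hu
  · exact signedSum_congr (fun μ => hζ.isPieri_iff.symm) _
  · rintro σ _ i hik hd rfl
    exact piOp_signedSum_isPieri hik hd

end CosetInduction

/-! ### Divided differences in the variables `y` -/

/-- The automorphism exchanging `xᵢ` and `yᵢ` for all `i`; it transports the divided differences
in `x` to those in `y`. -/
noncomputable def swapXY : RatFun n ≃+* RatFun n :=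
  IsFractionRing.ringEquivOfRingEquiv
    (MvPolynomial.renameEquiv ℤ (Equiv.sumComm (Fin n) (Fin n))).toRingEquiv

theorem swapXY_ratX (i : Fin n) : swapXY (ratX i) = ratY i := by
  simp [swapXY, ratX, ratY]

theorem swapXY_ratY (i : Fin n) : swapXY (ratY i) = ratX i := by
  simp [swapXY, ratX, ratY]

theorem swapXY_swapXY (f : RatFun n) : swapXY (swapXY f) = f :=
  congrArg (fun φ : RatFun n →+* RatFun n => φ f) <|
    ratFun_hom_ext (φ := (swapXY.trans swapXY).toRingHom) (ψ := RingHom.id _)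
      (fun i => by simp [swapXY_ratX, swapXY_ratY]) (fun i => by simp [swapXY_ratX, swapXY_ratY])

theorem swapXY_mem {f : RatFun n} (hf : f ∈ Laurent n) : swapXY f ∈ Laurent n := by
  induction hf using Algebra.adjoin_induction with
  | mem f hf =>
    rcases hf with ((⟨j, rfl⟩ | ⟨j, rfl⟩) | ⟨j, rfl⟩) | ⟨j, rfl⟩
    · exact swapXY_ratX j ▸ ratY_mem j
    · exact map_inv₀ swapXY (ratX j) ▸ swapXY_ratX j ▸ ratY_inv_mem j
    · exact swapXY_ratY j ▸ ratX_mem j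
    · exact map_inv₀ swapXY (ratY j) ▸ swapXY_ratY j ▸ ratX_inv_mem j
  | algebraMap r => simp
  | add f g _ _ hf hg => exact map_add swapXY f g ▸ add_mem hf hg
  | mul f g _ _ hf hg => exact map_mul swapXY f g ▸ mul_mem hf hg

/-- The action of a permutation on the variables `yᵢ`, the `xᵢ` being fixed. -/
noncomputable def permY (τ : Perm (Fin n)) : RatFun n ≃+* RatFun n :=
  (swapXY.trans (permX τ)).trans swapXY

theorem permY_apply (τ : Perm (Fin n)) (f : RatFun n) :
    permY τ f = swapXY (permX τ (swapXY f)) := rfl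

theorem permY_ratX (τ : Perm (Fin n)) (i : Fin n) : permY τ (ratX i) = ratX i := by
  rw [permY_apply, swapXY_ratX, permX_ratY, swapXY_ratY]

theorem permY_ratY (τ : Perm (Fin n)) (i : Fin n) : permY τ (ratY i) = ratY (τ i) := by
  rw [permY_apply, swapXY_ratY, permX_ratX, swapXY_ratX]

theorem permX_permY (σ τ : Perm (Fin n)) (f : RatFun n) :
    permX σ (permY τ f) = permY τ (permX σ f) :=
  congrArg (fun φ : RatFun n →+* RatFun n => φ f) <|
    ratFun_hom_ext (φ := ((permY τ).trans (permX σ)).toRingHom)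
      (ψ := ((permX σ).trans (permY τ)).toRingHom)
      (fun i => by simp [permX_ratX, permY_ratX]) (fun i => by simp [permX_ratY, permY_ratY])

theorem ratY_sub_ne_zero {i j : Fin n} (h : i ≠ j) : ratY i - ratY j ≠ 0 := by
  rw [← swapXY_ratX, ← swapXY_ratX, ← map_sub]
  exact (map_ne_zero swapXY).2 (ratX_sub_ne_zero h)

/-- The divided difference `f ↦ (f - f sⱼ) / (yⱼ - yⱼ₊₁)`, with `sⱼ` acting on the `y`. -/
noncomputable def divDiffY (j : Fin (n - 1)) (f : Laurent n) : Laurent n :=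
  ⟨swapXY (divDiff j ⟨swapXY f, swapXY_mem f.2⟩ : Laurent n), swapXY_mem (Subtype.prop _)⟩

/-- The isobaric divided difference `f ↦ (yⱼ₊₁ f - yⱼ (f sⱼ)) / (yⱼ₊₁ - yⱼ)`. The roles of `j` and
`j + 1` are exchanged with respect to `piOp` because `G_ω` is a polynomial in the `yⱼ / xᵢ`. -/
noncomputable def piY (j : Fin (n - 1)) (f : Laurent n) : Laurent n :=
  -divDiffY j (y (hi j) * f)

/-- The isobaric divided difference `f ↦ yⱼ (f - f sⱼ) / (yⱼ₊₁ - yⱼ)`. -/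
noncomputable def hatPiY (j : Fin (n - 1)) (f : Laurent n) : Laurent n :=
  -(y (lo j) * divDiffY j f)

section OperatorsY

variable {i j : Fin (n - 1)}

theorem coe_divDiffY (j : Fin (n - 1)) (f : Laurent n) :
    (divDiffY j f : RatFun n) =
      ((f : RatFun n) - permY (simple j) f) / (ratY (lo j) - ratY (hi j)) := by
  change swapXY (divDiff j _ : RatFun n) = _
  rw [coe_divDiff, map_div₀, map_sub, map_sub, swapXY_swapXY, swapXY_ratX, swapXY_ratX, permY_apply]

theorem coe_piY (j : Fin (n - 1)) (f : Laurent n) :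
    (piY j f : RatFun n) = -((ratY (hi j) * f - ratY (lo j) * permY (simple j) f) /
      (ratY (lo j) - ratY (hi j))) := by
  rw [piY, NegMemClass.coe_neg, coe_divDiffY, Subalgebra.coe_mul, map_mul, coe_y, permY_ratY,
    simple_hi]

theorem hatPiY_eq (j : Fin (n - 1)) (f : Laurent n) : hatPiY j f = piY j f - f := by
  apply Subtype.ext
  rw [hatPiY, NegMemClass.coe_neg, Subalgebra.coe_mul, Subalgebra.coe_sub, coe_piY, coe_divDiffY,
    coe_y]
  have hy := ratY_sub_ne_zero (lo_ne_hi j)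
  field_simp
  ring

theorem hatPiY_y_mul (j : Fin (n - 1)) (f : Laurent n) :
    hatPiY j (y (hi j) * f) = y (lo j) * piY j f := by
  rw [hatPiY, piY]
  ring

theorem piY_sub (j : Fin (n - 1)) (f g : Laurent n) : piY j (f - g) = piY j f - piY j g := by
  apply Subtype.ext
  simp only [coe_piY, Subalgebra.coe_sub, map_sub]
  ring

theorem hatPiY_sub (j : Fin (n - 1)) (f g : Laurent n) :
    hatPiY j (f - g) = hatPiY j f - hatPiY j g := by
  rw [hatPiY_eq, hatPiY_eq, hatPiY_eq, piY_sub]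
  ring

theorem hatPiY_mul_of_fixed {g : Laurent n} (hg : permY (simple j) (g : RatFun n) = g)
    (f : Laurent n) : hatPiY j (g * f) = g * hatPiY j f := by
  apply Subtype.ext
  simp only [hatPiY, NegMemClass.coe_neg, coe_divDiffY, Subalgebra.coe_mul, map_mul, hg]
  ring

theorem piOp_piY (i j : Fin (n - 1)) (f : Laurent n) : piOp i (piY j f) = piY j (piOp i f) := by
  apply Subtype.ext
  simp only [coe_piY, coe_piOp, map_neg, map_mul, map_div₀, map_sub, permX_ratY, permY_ratX,
    permX_permY]
  have hx := ratX_sub_ne_zero (lo_ne_hi i)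
  have hy := ratY_sub_ne_zero (lo_ne_hi j)
  field_simp
  ring

theorem hatPiOp_hatPiY (i j : Fin (n - 1)) (f : Laurent n) :
    hatPiOp i (hatPiY j f) = hatPiY j (hatPiOp i f) := by
  rw [hatPiOp_eq, hatPiOp_eq, hatPiY_eq, hatPiY_eq, piOp_sub, piY_sub, piOp_piY]
  ring

end OperatorsY

/-! ### Left multiplication by simple transpositions -/

/-- The boxes of the staircase shape other than the corner in row `i`. -/
def cornerlessStaircase (i : Fin (n - 1)) : Finset (Fin n × Fin n) :=
  {p | p.1.val + p.2.val + 1 < n ∧ p ≠ (lo i, lo i.rev)}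

section Staircase

variable {i j : Fin (n - 1)}

theorem mem_cornerlessStaircase {p : Fin n × Fin n} :
    p ∈ cornerlessStaircase i ↔
      p.1.val + p.2.val + 1 < n ∧ ¬ (p.1.val = i.val ∧ p.2.val + i.val + 2 = n) := by
  have hrev : (lo i.rev).val + i.val + 2 = n := by simp only [lo_val, Fin.val_rev]; omega
  simp only [cornerlessStaircase, mem_filter_univ, ne_eq, Prod.ext_iff, Fin.ext_iff]
  simp only [lo_val] at hrev ⊢
  omega

theorem val_simple (i : Fin (n - 1)) (a : Fin n) :
    (simple i a).val = if a.val = i.val then i.val + 1 else if a.val = i.val + 1 then i.val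
      else a.val := by
  rw [simple_eq_swap, swap_apply_def, apply_ite Fin.val, apply_ite Fin.val]
  simp only [Fin.ext_iff, lo_val, hi_val]

theorem simple_fst_mem_cornerlessStaircase (p : Fin n × Fin n) :
    (simple i p.1, p.2) ∈ cornerlessStaircase i ↔ p ∈ cornerlessStaircase i := by
  simp only [mem_cornerlessStaircase, val_simple]
  split_ifs <;> omega

theorem simple_rev_snd_mem_cornerlessStaircase (p : Fin n × Fin n) :
    (p.1, simple i.rev p.2) ∈ cornerlessStaircase i ↔ p ∈ cornerlessStaircase i := by
  simp only [mem_cornerlessStaircase, val_simple, Fin.val_rev]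
  split_ifs <;> omega

theorem coe_grothOmega_eq_prod : (grothOmega n : RatFun n) =
    ∏ p : Fin n × Fin n with p.1.val + p.2.val + 1 < n, (1 - ratY p.2 * (ratX p.1)⁻¹) := by
  rw [grothOmega, ← prod_product', prod_filter]
  simp only [SubmonoidClass.coe_finsetProd, univ_product_univ]
  refine prod_congr rfl fun p _ => ?_
  split_ifs
  · simp only [Subalgebra.coe_sub, Subalgebra.coe_one, Subalgebra.coe_mul, coe_y, coe_xInv]
  · rfl

/-- The product of the factors of `G_ω` other than the one in the corner of row `i`. -/
noncomputable def cornerlessProd (i : Fin (n - 1)) : RatFun n :=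
  ∏ p ∈ cornerlessStaircase i, (1 - ratY p.2 * (ratX p.1)⁻¹)

theorem coe_grothOmega_eq_mul (i : Fin (n - 1)) : (grothOmega n : RatFun n) =
    (1 - ratY (lo i.rev) * (ratX (lo i))⁻¹) * cornerlessProd i := by
  have hcorner : (lo i, lo i.rev) ∈
      (univ.filter fun p : Fin n × Fin n => p.1.val + p.2.val + 1 < n) := by
    simp only [mem_filter_univ, lo_val, Fin.val_rev]
    omega
  rw [coe_grothOmega_eq_prod, ← mul_prod_erase _ _ hcorner, cornerlessProd, cornerlessStaircase]
  congr 2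
  grind

theorem permX_cornerlessProd (i : Fin (n - 1)) :
    permX (simple i) (cornerlessProd i) = cornerlessProd i := by
  rw [cornerlessProd, map_prod]
  refine prod_equiv ((simple i).prodCongr (Equiv.refl _))
    (fun p => (simple_fst_mem_cornerlessStaircase p).symm) fun p _ => ?_
  simp [permX_ratX, permX_ratY]

theorem permY_cornerlessProd (i : Fin (n - 1)) :
    permY (simple i.rev) (cornerlessProd i) = cornerlessProd i := by
  rw [cornerlessProd, map_prod]
  refine prod_equiv ((Equiv.refl _).prodCongr (simple i.rev))
    (fun p => (simple_rev_snd_mem_cornerlessStaircase p).symm) fun p _ => ?_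
  simp [permY_ratX, permY_ratY]

theorem piOp_grothOmega (i : Fin (n - 1)) :
    piOp i (grothOmega n) = piY i.rev (grothOmega n) := by
  -- Both operators leave `cornerlessProd i` alone and replace the corner factor by `1`.
  apply Subtype.ext
  rw [coe_piOp, coe_piY, coe_grothOmega_eq_mul i, map_mul, map_mul, permX_cornerlessProd,
    permY_cornerlessProd]
  simp only [map_sub, map_one, map_mul, map_inv₀, permX_ratX, permX_ratY, permY_ratX, permY_ratY,
    simple_lo]
  have hx := ratX_sub_ne_zero (lo_ne_hi i)
  have hy := ratY_sub_ne_zero (lo_ne_hi i.rev)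
  have hlo := ratX_ne_zero (lo i)
  have hhi := ratX_ne_zero (hi i)
  field_simp
  ring

theorem hatPiOp_grothOmega (i : Fin (n - 1)) :
    hatPiOp i (grothOmega n) = hatPiY i.rev (grothOmega n) := by
  rw [hatPiOp_eq, piOp_grothOmega, hatPiY_eq]

theorem omega_lo (j : Fin (n - 1)) : omega n (lo j) = hi j.rev := by
  apply Fin.ext
  simp only [omega, Fin.revPerm_apply, Fin.val_rev, lo_val, hi_val]
  omega

theorem omega_hi (j : Fin (n - 1)) : omega n (hi j) = lo j.rev := by
  apply Fin.ext
  simp only [omega, Fin.revPerm_apply, Fin.val_rev, lo_val, hi_val]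
  omega

theorem omega_mul_simple (j : Fin (n - 1)) : omega n * simple j = simple j.rev * omega n := by
  rw [simple_eq_swap, mul_swap_eq_swap_mul, omega_lo, omega_hi, swap_comm, simple_eq_swap]

theorem omega_inv : (omega n)⁻¹ = omega n := inv_eq_of_mul_eq_one_left omega_mul_omega

variable {σ : Perm (Fin n)}

theorem IsReducedWord.cons_omega {l : List (Fin (n - 1))} (hl : IsReducedWord l (omega n * σ))
    (h : σ⁻¹ (hi j) < σ⁻¹ (lo j)) : IsReducedWord (j.rev :: l) (omega n * (simple j * σ)) := by
  rw [← mul_assoc, omega_mul_simple, mul_assoc]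
  refine hl.cons ?_
  simpa only [mul_inv_rev, Perm.mul_apply, omega_inv, omega_lo, omega_hi, Fin.rev_rev] using h

theorem groth_simple_mul (h : σ⁻¹ (hi j) < σ⁻¹ (lo j)) :
    groth (simple j * σ) = piY j (groth σ) := by
  obtain ⟨l, hl⟩ := exists_reducedWord (omega n * σ)
  rw [groth, groth, piPerm_eq_foldl hl, piPerm_eq_foldl (hl.cons_omega h), List.foldl_cons,
    piOp_grothOmega, Fin.rev_rev]
  exact List.foldl_hom (piY j) fun f i => piOp_piY i j f

theorem signedSum_rkLE_simple_mul (h : σ⁻¹ (hi j) < σ⁻¹ (lo j)) :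
    signedSum (RkLE (simple j * σ)) (len (simple j * σ)) =
      hatPiY j (signedSum (RkLE σ) (len σ)) := by
  obtain ⟨l, hl⟩ := exists_reducedWord (omega n * σ)
  have hsum := foldl_hatPiOp_grothOmega hl
  have hsum' := foldl_hatPiOp_grothOmega (hl.cons_omega h)
  rw [← mul_assoc, omega_mul_omega, one_mul] at hsum hsum'
  rw [← hsum, ← hsum', List.foldl_cons, hatPiOp_grothOmega, Fin.rev_rev]
  exact List.foldl_hom (hatPiY j) fun f i => hatPiOp_hatPiY i j f

theorem signedSum_rkLE_omega : signedSum (RkLE (omega n)) (len (omega n)) = grothOmega n := by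
  rw [signedSum_congr fun _ => rkLE_omega_iff, signedSum_eq_self, groth_omega]

end Staircase

/-! ### Operators modulo the ideal -/

section SymIdeal

open MvPolynomial (aeval)

variable {i j : Fin (n - 1)} {f g : Laurent n} {p : MvPolynomial (Fin n) ℤ}

/-- The generator `p(x₁, …, xₙ) - p(y₁, …, yₙ)` of the ideal, for `p` symmetric. -/
noncomputable def evalSub (p : MvPolynomial (Fin n) ℤ) : Laurent n := aeval x p - aeval y p

theorem evalSub_mem_symIdeal (hp : p.IsSymmetric) : evalSub p ∈ symIdeal n :=
  Ideal.subset_span ⟨p, hp, rfl⟩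

theorem map_coe_aeval {φ : RatFun n →+* RatFun n} {v w : Fin n → Laurent n}
    (h : ∀ a, φ (v a) = w a) (p : MvPolynomial (Fin n) ℤ) :
    φ (aeval v p : Laurent n) = (aeval w p : Laurent n) := by
  induction p using MvPolynomial.induction_on with
  | C a => simp
  | add p q hp hq => simp only [map_add, Subalgebra.coe_add, hp, hq]
  | mul_X p a hp => simp only [map_mul, Subalgebra.coe_mul, hp, MvPolynomial.aeval_X, h]

theorem permX_evalSub (hp : p.IsSymmetric) (τ : Perm (Fin n)) :
    permX τ (evalSub p : RatFun n) = evalSub p := by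
  have hx := map_coe_aeval (φ := (permX τ).toRingHom) (v := x) (w := x ∘ τ) (permX_ratX τ) p
  have hy := map_coe_aeval (φ := (permX τ).toRingHom) (v := y) (w := y) (permX_ratY τ) p
  rw [← MvPolynomial.aeval_rename, hp τ] at hx
  simp only [evalSub, Subalgebra.coe_sub, map_sub]
  exact congrArg₂ (· - ·) hx hy

theorem permY_evalSub (hp : p.IsSymmetric) (τ : Perm (Fin n)) :
    permY τ (evalSub p : RatFun n) = evalSub p := by
  have hx := map_coe_aeval (φ := (permY τ).toRingHom) (v := x) (w := x) (permY_ratX τ) p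
  have hy := map_coe_aeval (φ := (permY τ).toRingHom) (v := y) (w := y ∘ τ) (permY_ratY τ) p
  rw [← MvPolynomial.aeval_rename, hp τ] at hy
  simp only [evalSub, Subalgebra.coe_sub, map_sub]
  exact congrArg₂ (· - ·) hx hy

theorem map_mem_symIdeal (op : Laurent n →+ Laurent n)
    (hop : ∀ p : MvPolynomial (Fin n) ℤ, p.IsSymmetric → ∀ h, op (evalSub p * h) =
      evalSub p * op h) (hf : f ∈ symIdeal n) : op f ∈ symIdeal n := by
  suffices hmul : ∀ a, op (a * f) ∈ symIdeal n by simpa only [one_mul] using hmul 1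
  induction hf using Submodule.span_induction with
  | mem g hg =>
    obtain ⟨p, hp, rfl⟩ := hg
    intro a
    rw [mul_comm]
    exact hop p hp a ▸ Ideal.mul_mem_right _ _ (evalSub_mem_symIdeal hp)
  | zero => simp
  | add g h _ _ hg hh =>
    intro a
    rw [mul_add, map_add]
    exact add_mem (hg a) (hh a)
  | smul b g _ hg =>
    intro a
    rw [smul_eq_mul, ← mul_assoc]
    exact hg _

theorem mk_piOp_congr (i : Fin (n - 1))
    (h : Ideal.Quotient.mk (symIdeal n) f = Ideal.Quotient.mk (symIdeal n) g) :
    Ideal.Quotient.mk (symIdeal n) (piOp i f) = Ideal.Quotient.mk (symIdeal n) (piOp i g) := by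
  rw [Ideal.Quotient.eq] at h ⊢
  rw [← piOp_sub]
  exact map_mem_symIdeal (.ofMapSub (piOp i) (piOp_sub i))
    (fun p hp => piOp_mul_of_fixed (permX_evalSub hp _)) h

theorem mk_hatPiY_congr (j : Fin (n - 1))
    (h : Ideal.Quotient.mk (symIdeal n) f = Ideal.Quotient.mk (symIdeal n) g) :
    Ideal.Quotient.mk (symIdeal n) (hatPiY j f) =
      Ideal.Quotient.mk (symIdeal n) (hatPiY j g) := by
  rw [Ideal.Quotient.eq] at h ⊢
  rw [← hatPiY_sub]
  exact map_mem_symIdeal (.ofMapSub (hatPiY j) (hatPiY_sub j))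
    (fun p hp => hatPiY_mul_of_fixed (permY_evalSub hp _)) h

end SymIdeal

/-! ### The staircase product modulo the ideal -/

section StaircaseRows

open Polynomial

variable {R : Type*} [CommRing R] {v w u : ℕ → R} {m : ℕ}

/-- The first `m` rows of the staircase product `∏_{a + b < n - 1} (v a - w b)`. -/
def staircaseRows (n : ℕ) (v w : ℕ → R) (m : ℕ) : R :=
  ∏ a ∈ range m, ∏ b ∈ range (n - 1 - a), (v a - w b)

theorem staircaseRows_succ (n : ℕ) (v w : ℕ → R) (m : ℕ) :
    staircaseRows n v w (m + 1) =
      staircaseRows n v w m * ∏ b ∈ range (n - 1 - m), (v m - w b) :=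
  prod_range_succ _ _

theorem staircaseRows_succ_mul_sub (hm : m < n)
    (h : C (staircaseRows n v w m) *
      (∏ a ∈ Ico m n, (X - C (v a)) - ∏ b ∈ range (n - m), (X - C (w b))) = 0) :
    staircaseRows n v w (m + 1) * (v m - w (n - 1 - m)) = 0 := by
  have heval := congrArg (eval (v m)) h
  have hroot : ∏ a ∈ Ico m n, (v m - v a) = 0 :=
    prod_eq_zero (left_mem_Ico.2 hm) (sub_self _)
  simp only [eval_mul, eval_sub, eval_C, eval_prod, eval_X, eval_zero, hroot, zero_sub] at heval
  rwa [show n - m = n - 1 - m + 1 by omega, prod_range_succ, mul_neg, neg_eq_zero, ← mul_assoc,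
    ← staircaseRows_succ] at heval

-- Evaluating at `X = v m` shows that row `m` kills `v m - w (n - 1 - m)`; the two linear factors
-- `X - v m` and `X - w (n - 1 - m)` then agree and the monic one can be cancelled.
theorem staircaseRows_mul_prod_sub_prod
    (h : ∏ a ∈ range n, (X - C (v a)) = ∏ b ∈ range n, (X - C (w b))) (hm : m ≤ n) :
    C (staircaseRows n v w m) *
      (∏ a ∈ Ico m n, (X - C (v a)) - ∏ b ∈ range (n - m), (X - C (w b))) = 0 := by
  induction m with
  | zero => rw [Nat.sub_zero, ← range_eq_Ico, h, sub_self, mul_zero]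
  | succ m ih =>
    have hrow := ih (by omega)
    have hkill := congrArg C (staircaseRows_succ_mul_sub hm hrow)
    rw [show n - m = n - 1 - m + 1 by omega, prod_range_succ, prod_eq_prod_Ico_succ_bot hm] at hrow
    rw [C_mul, C_sub, C_0, staircaseRows_succ, C_mul] at hkill
    rw [← (monic_X_sub_C (v m)).mul_right_eq_zero_iff, staircaseRows_succ, C_mul,
      show n - (m + 1) = n - 1 - m by omega]
    linear_combination (C (∏ b ∈ range (n - 1 - m), (v m - w b))) * hrow +
      (∏ b ∈ range (n - 1 - m), (X - C (w b))) * hkill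

theorem staircaseRows_mul_sub
    (h : ∏ a ∈ range n, (X - C (v a)) = ∏ b ∈ range n, (X - C (w b))) (hm : m < n) :
    staircaseRows n v w n * (v m - w (n - 1 - m)) = 0 := by
  obtain ⟨c, hc⟩ : staircaseRows n v w (m + 1) ∣ staircaseRows n v w n :=
    prod_dvd_prod_of_subset _ _ _ (range_subset_range.2 hm)
  rw [hc, mul_right_comm,
    staircaseRows_succ_mul_sub hm (staircaseRows_mul_prod_sub_prod h hm.le), zero_mul]

theorem staircase_mul_ratio
    (h : ∏ a ∈ range n, (X - C (v a)) = ∏ b ∈ range n, (X - C (w b)))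
    (hu : ∀ a < n, v a * u a = 1) (hm : m < n) :
    (∏ a ∈ range n, ∏ b ∈ range (n - 1 - a), (1 - w b * u a)) * (w (n - 1 - m) * u m) =
      ∏ a ∈ range n, ∏ b ∈ range (n - 1 - a), (1 - w b * u a) := by
  have hfactor : ∏ a ∈ range n, ∏ b ∈ range (n - 1 - a), (1 - w b * u a) =
      staircaseRows n v w n * ∏ a ∈ range n, ∏ _b ∈ range (n - 1 - a), u a := by
    simp only [staircaseRows, ← prod_mul_distrib]
    refine prod_congr rfl fun a ha => prod_congr rfl fun b _ => ?_
    rw [sub_mul, hu a (mem_range.1 ha)]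
  rw [hfactor]
  set U := ∏ a ∈ range n, ∏ _b ∈ range (n - 1 - a), u a
  linear_combination (-(u m * U)) * staircaseRows_mul_sub h hm +
    (staircaseRows n v w n * U) * hu m hm

theorem prod_X_sub_C_eq_of_isSymmetric {ι S : Type*} [Fintype ι] [CommRing S] [Algebra S R]
    {v w : ι → R} (h : ∀ p : MvPolynomial ι S, p.IsSymmetric →
      MvPolynomial.aeval v p = MvPolynomial.aeval w p) :
    ∏ a, (X - C (v a)) = ∏ a, (X - C (w a)) := by
  have hesymm : ∀ d, (univ.val.map v).esymm d = (univ.val.map w).esymm d := fun d => by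
    simpa only [MvPolynomial.aeval_esymm_eq_multiset_esymm] using
      h _ (MvPolynomial.esymm_isSymmetric ι S d)
  have hv := (univ.val.map v).prod_X_sub_X_eq_sum_esymm
  have hw := (univ.val.map w).prod_X_sub_X_eq_sum_esymm
  simp only [Multiset.map_map, Multiset.card_map, hesymm] at hv hw
  exact hv.trans hw.symm

theorem prod_ite_add_lt {M : Type*} [CommMonoid M] (a : ℕ) (f : ℕ → M) :
    ∏ b : Fin n, (if a + b.val + 1 < n then f b else 1) = ∏ b ∈ range (n - 1 - a), f b := by
  rw [← prod_range fun b => if a + b + 1 < n then f b else 1, ← prod_filter]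
  congr 1
  ext b
  simp only [mem_filter, mem_range]
  omega

theorem staircase_mul_ratio_of_isSymmetric {S : Type*} [CommRing S] [Algebra S R]
    {v w u : Fin n → R} (h : ∀ p : MvPolynomial (Fin n) S, p.IsSymmetric →
      MvPolynomial.aeval v p = MvPolynomial.aeval w p)
    (hu : ∀ a, v a * u a = 1) (c : Fin n) :
    (∏ a : Fin n, ∏ b : Fin n, if a.val + b.val + 1 < n then 1 - w b * u a else 1) *
        (w (omega n c) * u c) =
      ∏ a : Fin n, ∏ b : Fin n, if a.val + b.val + 1 < n then 1 - w b * u a else 1 := by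
  let ext (f : Fin n → R) : ℕ → R := Function.extend Fin.val f 0
  have ext_val (f : Fin n → R) (a : Fin n) : ext f a = f a :=
    Fin.val_injective.extend_apply f 0 a
  have hprod : ∏ a ∈ range n, (X - C (ext v a)) = ∏ b ∈ range n, (X - C (ext w b)) := by
    simpa only [prod_range, ext_val] using prod_X_sub_C_eq_of_isSymmetric h
  have hω : n - 1 - c.val = (omega n c).val := by
    simp only [omega, Fin.revPerm_apply, Fin.val_rev]
    omega
  have hinv : ∀ a < n, ext v a * ext u a = 1 := fun a ha =>
    (congrArg₂ (· * ·) (ext_val v ⟨a, ha⟩) (ext_val u ⟨a, ha⟩)).trans (hu ⟨a, ha⟩)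
  have key := staircase_mul_ratio hprod hinv c.isLt
  simp only [← prod_ite_add_lt] at key
  simpa only [prod_range, hω, ext_val] using key

theorem mk_staircase_mul_ratio {S : Type*} [CommRing S] [Algebra S R] {J : Ideal R}
    {v w u : Fin n → R} (h : ∀ p : MvPolynomial (Fin n) S, p.IsSymmetric →
      MvPolynomial.aeval v p - MvPolynomial.aeval w p ∈ J)
    (hu : ∀ a, v a * u a = 1) (c : Fin n) :
    Ideal.Quotient.mk J ((∏ a : Fin n, ∏ b : Fin n,
        if a.val + b.val + 1 < n then 1 - w b * u a else 1) * (w (omega n c) * u c)) =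
      Ideal.Quotient.mk J (∏ a : Fin n, ∏ b : Fin n,
        if a.val + b.val + 1 < n then 1 - w b * u a else 1) := by
  set q := Ideal.Quotient.mk J
  have aeval_mk (v : Fin n → R) (p : MvPolynomial (Fin n) S) :
      MvPolynomial.aeval (fun a => q (v a)) p = q (MvPolynomial.aeval v p) :=
    (MvPolynomial.comp_aeval_apply v (Ideal.Quotient.mkₐ S J) p).symm
  have key := staircase_mul_ratio_of_isSymmetric (S := S) (v := fun a => q (v a))
    (w := fun a => q (w a)) (u := fun a => q (u a))
    (fun p hp => by rw [aeval_mk, aeval_mk]; exact Ideal.Quotient.eq.2 (h p hp))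
    (fun a => by rw [← map_mul, hu, map_one]) c
  simpa only [map_mul, map_prod, apply_ite q, map_sub, map_one] using key

end StaircaseRows

theorem x_mul_xInv (a : Fin n) : (x a * xInv a : Laurent n) = 1 :=
  Subtype.ext (mul_inv_cancel₀ (ratX_ne_zero a))

theorem mk_grothOmega_mul_ratio (c : Fin n) :
    Ideal.Quotient.mk (symIdeal n) (grothOmega n * (y (omega n c) * xInv c)) =
      Ideal.Quotient.mk (symIdeal n) (grothOmega n) := by
  have hgen : ∀ p : MvPolynomial (Fin n) ℤ, p.IsSymmetric →
      MvPolynomial.aeval (x (n := n)) p - MvPolynomial.aeval (y (n := n)) p ∈ symIdeal n :=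
    fun p hp => evalSub_mem_symIdeal hp
  rw [grothOmega]
  exact mk_staircase_mul_ratio (J := symIdeal n) (v := x) (w := y) (u := xInv) hgen x_mul_xInv c

/-! ### The congruence -/

/-- The monomial `y_{σ₁} ⋯ y_{σ_k} / (x₁ ⋯ x_k)`. -/
noncomputable def ratioMonomial (k : ℕ) (σ : Perm (Fin n)) : Laurent n :=
  ∏ i : Fin n, if i.val < k then y (σ i) * xInv i else 1

section Congruence

variable {k : ℕ} {i j : Fin (n - 1)} {σ ζ u : Perm (Fin n)}

theorem mk_grothOmega_mul_ratioMonomial (k : ℕ) :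
    Ideal.Quotient.mk (symIdeal n) (grothOmega n * ratioMonomial k (omega n)) =
      Ideal.Quotient.mk (symIdeal n) (grothOmega n) := by
  refine prod_induction _ (fun c => Ideal.Quotient.mk (symIdeal n) (grothOmega n * c) =
    Ideal.Quotient.mk (symIdeal n) (grothOmega n)) (fun c d hc hd => ?_) (by rw [mul_one])
    fun i _ => ?_
  · rw [← mul_assoc, map_mul, hc, ← map_mul, hd]
  · split_ifs
    · exact mk_grothOmega_mul_ratio i
    · rw [mul_one]

theorem exists_ratioMonomial_eq (hhi : (σ⁻¹ (hi j)).val < k) (hlo : k ≤ (σ⁻¹ (lo j)).val) :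
    ∃ Z : Laurent n, permY (simple j) (Z : RatFun n) = Z ∧
      ratioMonomial k σ = y (hi j) * Z ∧ ratioMonomial k (simple j * σ) = y (lo j) * Z := by
  set a := σ⁻¹ (hi j)
  have hσa : σ a = hi j := σ.apply_symm_apply _
  have hne : ∀ i ≠ a, i.val < k → simple j (σ i) = σ i := fun i hia hik => by
    refine simple_apply_of_ne (fun h => ?_) fun h => hia (Perm.eq_inv_iff_eq.2 h)
    rw [Perm.eq_inv_iff_eq.2 h] at hik
    exact hlo.not_gt hik
  have hfactor : ∀ τ : Perm (Fin n), (∀ i ≠ a, i.val < k → τ i = σ i) → ratioMonomial k τ =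
      y (τ a) * (xInv a * ∏ i ∈ univ.erase a, if i.val < k then y (σ i) * xInv i else 1) := by
    intro τ hτ
    rw [ratioMonomial, ← mul_prod_erase univ _ (mem_univ a), if_pos hhi, mul_assoc]
    refine congrArg (fun c => y (τ a) * (xInv a * c)) (prod_congr rfl fun i hi => ?_)
    split_ifs with hik
    · rw [hτ i (ne_of_mem_erase hi) hik]
    · rfl
  refine ⟨_, ?_, hσa ▸ hfactor σ fun _ _ _ => rfl, ?_⟩
  · simp only [Subalgebra.coe_mul, SubmonoidClass.coe_finsetProd, map_mul, map_prod, coe_xInv,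
      map_inv₀, permY_ratX]
    refine congrArg _ (prod_congr rfl fun i hi => ?_)
    split_ifs with hik
    · simp only [Subalgebra.coe_mul, coe_y, coe_xInv, map_mul, map_inv₀, permY_ratX, permY_ratY,
        hne i (ne_of_mem_erase hi) hik]
    · exact map_one _
  · simpa only [Perm.mul_apply, hσa, simple_hi] using hfactor (simple j * σ) hne

theorem hatPiY_groth_mul_ratioMonomial (hhi : (σ⁻¹ (hi j)).val < k)
    (hlo : k ≤ (σ⁻¹ (lo j)).val) : hatPiY j (groth σ * ratioMonomial k σ) =
      groth (simple j * σ) * ratioMonomial k (simple j * σ) := by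
  obtain ⟨Z, hZ, hσ, hsσ⟩ := exists_ratioMonomial_eq hhi hlo
  calc hatPiY j (groth σ * ratioMonomial k σ)
      = hatPiY j (Z * (y (hi j) * groth σ)) := by rw [hσ]; ring_nf
    _ = Z * (y (lo j) * piY j (groth σ)) := by rw [hatPiY_mul_of_fixed hZ, hatPiY_y_mul]
    _ = groth (simple j * σ) * ratioMonomial k (simple j * σ) := by
      rw [groth_simple_mul (Fin.lt_def.2 (hhi.trans_le hlo)), hsσ]
      ring

theorem eq_omega_of_forall_descent (h : ∀ j, σ (hi j) < σ (lo j)) : σ = omega n := by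
  have hone : omega n * σ = 1 := eq_one_of_no_descent fun i => by
    simpa [omega_lt_omega] using h i
  rw [← omega_inv, eq_inv_of_mul_eq_one_right hone]

theorem omega_induction {motive : Perm (Fin n) → Prop} (omega : motive (omega n))
    (simple_mul : ∀ σ j, σ⁻¹ (hi j) < σ⁻¹ (lo j) → motive σ → motive (simple j * σ))
    (σ : Perm (Fin n)) : motive σ := by
  induction hm : n * n - len σ using Nat.strong_induction_on generalizing σ with
  | _ m ih =>
  by_cases hdesc : ∀ j, σ⁻¹ (hi j) < σ⁻¹ (lo j)
  · rwa [← inv_inv σ, eq_omega_of_forall_descent hdesc, omega_inv]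
  · push Not at hdesc
    obtain ⟨j, hj⟩ := hdesc
    have hasc : σ⁻¹ (lo j) < σ⁻¹ (hi j) := hj.lt_of_ne fun h => lo_ne_hi j (σ⁻¹.injective h)
    have hlen := len_simple_mul_of_ascent hasc
    have hle := len_le_mul_self (simple j * σ)
    have hmotive := ih _ (by omega) (simple j * σ) rfl
    have hdescent : (simple j * σ)⁻¹ (hi j) < (simple j * σ)⁻¹ (lo j) := by
      simpa only [mul_inv_rev, simple_inv, Perm.mul_apply, simple_lo, simple_hi] using hasc
    simpa only [← mul_assoc, simple_mul_self, one_mul] using simple_mul _ j hdescent hmotive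

theorem BlockDecreasing.of_simple_mul (h : BlockDecreasing k (simple j * σ))
    (hj : σ⁻¹ (hi j) < σ⁻¹ (lo j)) : BlockDecreasing k σ := by
  intro a b hab hk
  have hne : ¬((simple j * σ) b = lo j ∧ (simple j * σ) a = hi j) := fun ⟨hb, ha⟩ => by
    have hb' : b = σ⁻¹ (hi j) := Perm.eq_inv_iff_eq.2 <| (simple j).injective <| by
      rwa [simple_hi]
    have ha' : a = σ⁻¹ (lo j) := Perm.eq_inv_iff_eq.2 <| (simple j).injective <| by
      rwa [simple_lo]
    exact hab.not_gt (by rwa [ha', hb'])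
  simpa using simple_lt_simple (h a b hab hk) hne

theorem BlockDecreasing.mk_groth_mul_ratioMonomial (hζ : BlockDecreasing k ζ) :
    Ideal.Quotient.mk (symIdeal n) (groth ζ * ratioMonomial k ζ) =
      Ideal.Quotient.mk (symIdeal n) (signedSum (RkLE ζ) (len ζ)) := by
  induction ζ using omega_induction with
  | omega => rw [groth_omega, mk_grothOmega_mul_ratioMonomial, signedSum_rkLE_omega]
  | simple_mul σ j hj ih =>
    have hblocks : (σ⁻¹ (hi j)).val < k ∧ k ≤ (σ⁻¹ (lo j)).val := by
      by_contra hsame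
      have hlt := hζ _ _ hj (by omega)
      simp only [Perm.mul_apply, ← Perm.mul_apply σ, mul_inv_cancel, Perm.one_apply, simple_lo,
        simple_hi] at hlt
      exact hlt.not_gt (lo_lt_hi j)
    rw [← hatPiY_groth_mul_ratioMonomial hblocks.1 hblocks.2, signedSum_rkLE_simple_mul hj]
    exact mk_hatPiY_congr j (ih (hζ.of_simple_mul hj))

theorem ratioMonomial_eq_prod_mul_prod (k : ℕ) (σ : Perm (Fin n)) :
    ratioMonomial k σ = (∏ c : Fin n, if c.val < k then y (σ c) else 1) *
      ∏ c : Fin n, if c.val < k then xInv c else 1 := by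
  rw [ratioMonomial, ← prod_mul_distrib]
  refine prod_congr rfl fun c _ => ?_
  split_ifs
  · rfl
  · rw [one_mul]

theorem prod_ite_comp_of_mem_youngSubgroup {M : Type*} [CommMonoid M]
    (hu : u ∈ youngSubgroup n k) (f : Fin n → M) :
    (∏ c : Fin n, if c.val < k then f (u c) else 1) =
      ∏ c : Fin n, if c.val < k then f c else 1 := by
  rw [← Equiv.prod_comp u fun c => if c.val < k then f c else 1]
  exact prod_congr rfl fun c _ => by simp only [hu c]

theorem ratioMonomial_mul (hu : u ∈ youngSubgroup n k) (σ : Perm (Fin n)) :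
    ratioMonomial k (σ * u) = ratioMonomial k σ := by
  simp only [ratioMonomial_eq_prod_mul_prod, Perm.mul_apply]
  rw [prod_ite_comp_of_mem_youngSubgroup hu fun c => y (σ c)]

theorem permX_ratioMonomial (hu : u ∈ youngSubgroup n k) (σ : Perm (Fin n)) :
    permX u (ratioMonomial k σ : RatFun n) = ratioMonomial k σ := by
  simp only [ratioMonomial_eq_prod_mul_prod, Subalgebra.coe_mul, SubmonoidClass.coe_finsetProd,
    map_mul, map_prod, apply_ite (fun f : Laurent n => (f : RatFun n)), apply_ite (permX u),
    coe_y, coe_xInv, Subalgebra.coe_one, map_one, map_inv₀, permX_ratY, permX_ratX]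
  rw [prod_ite_comp_of_mem_youngSubgroup hu fun c => (ratX c)⁻¹]

theorem BlockDecreasing.mk_groth_mul_ratioMonomial_mul (hζ : BlockDecreasing k ζ)
    (hu : u ∈ youngSubgroup n k) :
    Ideal.Quotient.mk (symIdeal n) (groth (ζ * u) * ratioMonomial k (ζ * u)) =
      Ideal.Quotient.mk (symIdeal n) (piPerm u (signedSum (RkLE ζ) (len ζ))) := by
  refine hζ.piPerm_induction (motive := fun σ f => Ideal.Quotient.mk (symIdeal n)
    (groth σ * ratioMonomial k σ) = Ideal.Quotient.mk (symIdeal n) f)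
    hζ.mk_groth_mul_ratioMonomial (fun σ f i hik hdescent hmk => ?_) hu
  have hi := simple_mem_youngSubgroup hik
  rw [← mk_piOp_congr i hmk, mul_comm (groth σ), piOp_mul_of_fixed (permX_ratioMonomial hi σ),
    piOp_groth_of_descent hdescent, ratioMonomial_mul hi, mul_comm]

end Congruence

theorem signedSum_isPieri_eq_sum_bruhatInterval (k : ℕ) (σ : Perm (Fin n)) :
    signedSum (IsPieri k σ) (len σ) =
      ∑ μ ∈ bruhatInterval σ (eta k σ), (-1) ^ (len μ - len σ) * groth μ := by
  classical
  rw [signedSum]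
  refine sum_congr (by ext μ; simp [mem_bruhatInterval_eta]) fun μ hμ => ?_
  have hle := (mem_bruhatInterval_eta.1 hμ).rkLE.len_le
  have hsq : (-1 : Laurent n) ^ (len σ + len σ) = 1 := Subtype.ext (Even.add_self _).neg_one_pow
  rw [show len μ + len σ = len μ - len σ + (len σ + len σ) by omega, pow_add, hsq, mul_one]

end GrothPieri

theorem mainTheorem1 (n k : ℕ) (hk : 1 ≤ k) (hkn : k < n) (σ : Equiv.Perm (Fin n)) :
    ∃ ζ : Equiv.Perm (Fin n), IsCosetMax k σ ζ ∧
      Ideal.Quotient.mk (symIdeal n)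
          (groth σ * ∏ i : Fin n, if i.val < k then y (σ i) * xInv i else 1) =
        Ideal.Quotient.mk (symIdeal n)
          (piPerm (ζ⁻¹ * σ) (hatPiPerm (omega n * ζ) (groth (omega n)))) ∧
      BruhatLE σ (eta k σ) ∧
      piPerm (ζ⁻¹ * σ) (hatPiPerm (omega n * ζ) (groth (omega n))) =
        ∑ μ ∈ bruhatInterval σ (eta k σ), (-1) ^ (len μ - len σ) * groth μ := by
  obtain ⟨τ, hτ, hdec⟩ := exists_blockDecreasing k σ
  have hu : (σ * τ)⁻¹ * σ ∈ youngSubgroup n k := by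
    rw [mul_inv_rev, inv_mul_cancel_right]
    exact inv_mem hτ
  have hσ : σ * τ * ((σ * τ)⁻¹ * σ) = σ := mul_inv_cancel_left _ _
  have hhat : hatPiPerm (omega n * (σ * τ)) (groth (omega n)) =
      signedSum (RkLE (σ * τ)) (len (σ * τ)) := by
    rw [groth_omega, hatPiPerm_grothOmega, ← mul_assoc, omega_mul_omega, one_mul]
  refine ⟨σ * τ, hdec.isCosetMax hτ, ?_, bruhatLE_eta k σ, ?_⟩
  · have hmk := hdec.mk_groth_mul_ratioMonomial_mul hu
    rwa [hσ, ← hhat] at hmk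
  · rw [hhat, hdec.piPerm_signedSum hu, hσ, signedSum_isPieri_eq_sum_bruhatInterval]
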